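/- Let $\mathcal P[0,1]$ be the space of Borel probability measures on $[0,1]$ with the weak topology, and $\lambda$ the Lebesgue measure on $[0,1]$. A *qmm-space* (quantum metric measure space) is a triple $X=(X,\mu_X,d_X)$, where $X$ is a standard Borel space, $\mu_X$ is a Borel probability measure on $X$, and $d_X:X\times X\to\mathcal P[0,1]$ is a Borel map with $d_X(x,x)=\delta_0$ and $d_X(x,y)=d_X(y,x)$, such that for $\mu_X^3$-almost every triple $(a,b,c)$, if $a,b,c$ are distinct, then independent random lengths $l(a,b),l(b,c),l(a,c)$ with laws $d_X(a,b),d_X(b,c),d_X(a,c)$ almost surely satisfy the three triangle inequalities. Let $M_\infty$ be the space of infinite symmetric matrices $(d_{i,j})_{i,j\ge1}$ with entries in $[0,1]$ and zero diagonal. For a sequence $x=(x_i)$ in $X$ let $s_x$ be the probability measure on $M_\infty$ under which the entries $d_{i,j}$, $i<j$, are independent with laws $d_X(x_i,x_j)$. The *sampling measure* $\tau(X)$ is the barycenter $\tau(X)=\int s_x\,d\mu_X^{\mathbb N}(x)$, a Borel probability measure on $M_\infty$. Let $d_{ext}(\mu,\nu)=\sup\{|\int f\,d\mu-\int f\,d\nu|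 : f:[0,1]\to\mathbb R \text{ 1-Lipschitz}\}$ on $\mathcal P[0,1]$. For $f,g:[0,1]^2\to\mathcal P[0,1]$ (measurable, and regarded modulo $\lambda^2$-null sets) let $\square_1(f,g)$ be the infimum of all $\varepsilon\ge0$ for which there is a measurable set $S\subseteq[0,1]$ with $\lambda(S)\le\varepsilon$ such that $d_{ext}(f(s,t),g(s,t))\le\varepsilon$ for $\lambda^2$-almost every $(s,t)\in([0,1]\setminus S)^2$. Let $MPM(X)$ be the set of measure-preserving maps $\Psi:([0,1],\lambda)\to(X,\mu_X)$, write $\Psi^{-1}(d_X)(s,t)=d_X(\Psi(s),\Psi(t))$, and put $$\underline{\square}_1(X,Y)=\inf_{\Psi_1\in MPM(X),\ \Psi_2\in MPM(Y)}\square_1\big(\Psi_1^{-1}(d_X),\Psi_2^{-1}(d_Y)\big).$$ **Theorem.** Let $X,Y$ be qmm-spaces. Then $\tau(X)=\tau(Y)$ if and only if $\underline{\square}_1(X,Y)=0$. In fact, if $\tau(X)=\tau(Y)$, then there exist $\Psi_1\in MPM(X)$ and $\Psi_2\in MPM(Y)$ such that $\Psi_1^{-1}(d_X)=\Psi_2^{-1}(d_Y)$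 $\lambda^2$-almost everywhere on $[0,1]^2$. -/

import Mathlib

open MeasureTheory unitInterval
open scoped ENNReal

noncomputable section

/-- A quantum metric measure space on the standard Borel space `X`: a Borel probability measure
`μ` and a symmetric Borel map `d : X × X → 𝒫[0,1]` with `d x x = δ₀`, such that for almost every
triple of distinct points the independent random lengths of the three sides satisfy the triangle
inequalities almost surely. The `σ`-algebra on `ProbabilityMeasure I` is generated by the
evaluations `ν ↦ ν A`; it is the Borel `σ`-algebra of the weak topology. -/
structure QMMSpace (X : Type*) [MeasurableSpace X] [StandardBorelSpace X] where
  μ : ProbabilityMeasure X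
  d : X → X → ProbabilityMeasure I
  measurable_d : Measurable fun p : X × X => d p.1 p.2
  d_self : ∀ x, d x x = diracProba 0
  d_symm : ∀ x y, d x y = d y x
  triangle : ∀ᵐ t : X × X × X ∂((μ : Measure X).prod ((μ : Measure X).prod (μ : Measure X))),
    t.1 ≠ t.2.1 → t.2.1 ≠ t.2.2 → t.1 ≠ t.2.2 →
      ∀ᵐ l : I × I × I ∂((d t.1 t.2.1 : Measure I).prod
          ((d t.2.1 t.2.2 : Measure I).prod (d t.1 t.2.2 : Measure I))),
        (l.1 : ℝ) ≤ l.2.1 + l.2.2 ∧ (l.2.1 : ℝ) ≤ l.1 + l.2.2 ∧ (l.2.2 : ℝ) ≤ l.1 + l.2.1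

namespace QMMSpace

/-- `M_∞`: the infinite symmetric matrices with entries in `[0,1]` and zero diagonal. -/
def DistMatrix : Type := {m : ℕ → ℕ → I // (∀ i j, m i j = m j i) ∧ ∀ i, m i i = 0}

instance : MeasurableSpace DistMatrix := inferInstanceAs (MeasurableSpace (Subtype _))

/-- `M̂_∞`: the infinite symmetric matrices with entries in `𝒫[0,1]` and diagonal `δ₀`. -/
def LawMatrix : Type :=
  {m : ℕ → ℕ → ProbabilityMeasure I // (∀ i j, m i j = m j i) ∧
    ∀ i, m i i = diracProba 0}

instance : MeasurableSpace LawMatrix := inferInstanceAs (MeasurableSpace (Subtype _))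

/-- The positions above the diagonal. -/
abbrev Pairs : Type := {p : ℕ × ℕ // p.1 < p.2}

/-- The symmetric matrix with zero diagonal and the given entries above the diagonal. -/
def symmetrize (u : Pairs → I) : DistMatrix :=
  ⟨fun i j => if h : i < j then u ⟨(i, j), h⟩ else if h : j < i then u ⟨(j, i), h⟩ else 0, by
    refine ⟨fun i j => ?_, fun i => by simp⟩
    rcases lt_trichotomy i j with h | h | h
    · simp [h, h.not_gt]
    · simp [h]
    · simp [h, h.not_gt]⟩

theorem measurable_symmetrize : Measurable symmetrize := by
  refine Measurable.subtype_mk (measurable_pi_iff.2 fun i => measurable_pi_iff.2 fun j => ?_)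
  by_cases h : i < j
  · simpa [h] using measurable_pi_apply _
  · by_cases h' : j < i
    · simpa [h, h'] using measurable_pi_apply _
    · simp [h, h']

/-- The probability measure on `M_∞` defined by `s ∈ M̂_∞`: the entries above the diagonal are
independent with laws `s i j`. -/
def LawMatrix.toMeasure (s : LawMatrix) : Measure DistMatrix :=
  (Measure.infinitePi fun p : Pairs => (s.1 p.1.1 p.1.2 : Measure I)).map symmetrize

instance (s : LawMatrix) : IsProbabilityMeasure s.toMeasure :=
  Measure.isProbabilityMeasure_map measurable_symmetrize.aemeasurable

theorem LawMatrix.measurable_toMeasure : Measurable LawMatrix.toMeasure := by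
  refine (Measure.measurable_map _ measurable_symmetrize).comp ?_
  refine Measurable.measure_of_isPiSystem_of_isProbabilityMeasure
    generateFrom_squareCylinders.symm
    (isPiSystem_squareCylinders (fun _ => MeasurableSpace.isPiSystem_measurableSet) (by simp)) ?_
  rintro _ ⟨s, t, ht, rfl⟩
  have ht' : ∀ p, MeasurableSet (t p) := fun p => ht p (Set.mem_univ p)
  simp_rw [Measure.infinitePi_pi _ fun p _ => ht' p]
  refine Finset.measurable_prod _ fun p _ => (Measure.measurable_coe (ht' p)).comp ?_
  exact measurable_subtype_coe.comp ((measurable_pi_apply _).comp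
    ((measurable_pi_apply _).comp measurable_subtype_coe))

variable {X : Type*} [MeasurableSpace X] [StandardBorelSpace X]

/-- The map `X^ℕ → M̂_∞`, `(x_i) ↦ (d (x_i) (x_j))`. -/
def lawMatrix (Q : QMMSpace X) (x : ℕ → X) : LawMatrix :=
  ⟨fun i j => Q.d (x i) (x j), fun _ _ => Q.d_symm _ _, fun _ => Q.d_self _⟩

theorem measurable_lawMatrix (Q : QMMSpace X) : Measurable Q.lawMatrix :=
  Measurable.subtype_mk (measurable_pi_iff.2 fun i => measurable_pi_iff.2 fun j =>
    Q.measurable_d.comp ((measurable_pi_apply i).prodMk (measurable_pi_apply j)))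

/-- The law `ν` on `M̂_∞`: the push-forward of `μ × μ × ⋯`. -/
def lawMatrixMeasure (Q : QMMSpace X) : Measure LawMatrix :=
  (Measure.infinitePi fun _ : ℕ => (Q.μ : Measure X)).map Q.lawMatrix

instance (Q : QMMSpace X) : IsProbabilityMeasure Q.lawMatrixMeasure :=
  Measure.isProbabilityMeasure_map Q.measurable_lawMatrix.aemeasurable

/-- The sampling measure `τ(X)` on `M_∞`: the barycenter of the law `ν`, that is
`τ(X)(A) = ∫ s(A) dν(s)`. -/
def τ (Q : QMMSpace X) : ProbabilityMeasure DistMatrix :=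
  ⟨Q.lawMatrixMeasure.bind LawMatrix.toMeasure, ⟨by
    rw [Measure.bind_apply MeasurableSet.univ LawMatrix.measurable_toMeasure.aemeasurable]
    simp⟩⟩

/-- Measure preserving maps `([0,1], λ) → (X, μ)`. -/
def MPM (Q : QMMSpace X) : Type _ := {Ψ : I → X // MeasurePreserving Ψ volume (Q.μ : Measure X)}

/-- The pull-back of the distance function of `X` to `[0,1] × [0,1]`. -/
def pullback (Q : QMMSpace X) (Ψ : Q.MPM) : I → I → ProbabilityMeasure I :=
  fun s t => Q.d (Ψ.1 s) (Ψ.1 t)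

/-- The extension of the distance of `[0,1]` to `𝒫[0,1]`. -/
def dExt (μ ν : ProbabilityMeasure I) : ℝ≥0∞ :=
  ⨆ (f : I → ℝ) (_ : LipschitzWith 1 f),
    ENNReal.ofReal |∫ t, f t ∂(μ : Measure I) - ∫ t, f t ∂(ν : Measure I)|

/-- The `□₁`-distance of `𝒫[0,1]`-valued functions on `[0,1]²`, as classes modulo null sets: the
infimal `ε` such that `f` and `g` are `ε`-close at almost every point of `Sᶜ × Sᶜ`, for some
`S ⊆ [0,1]` of measure at most `ε`. -/
def box (f g : I → I → ProbabilityMeasure I) : ℝ≥0∞ :=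
  sInf {ε | ∃ S : Set I, MeasurableSet S ∧ volume S ≤ ε ∧
    ∀ᵐ p : I × I ∂(volume.prod volume), p.1 ∉ S → p.2 ∉ S → dExt (f p.1 p.2) (g p.1 p.2) ≤ ε}

/-- The box distance of two qmm-spaces. -/
def boxDist {Y : Type*} [MeasurableSpace Y] [StandardBorelSpace Y]
    (P : QMMSpace X) (Q : QMMSpace Y) : ℝ≥0∞ :=
  ⨅ (Ψ₁ : P.MPM) (Ψ₂ : Q.MPM), box (P.pullback Ψ₁) (Q.pullback Ψ₂)

end QMMSpace

end

/-!
Sample a space at i.i.d. points, call the points of index `3l` anchors, and group the other points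
in pairs. Given the anchors `c`, the triples formed by the rows of lengths from the two points of a
pair to the anchors, and by the length between the two points, are i.i.d.; let `pairLaw c` be their
law. By the law of large numbers, the sampling measure determines the law of the random measure
`pairLaw c`.

The type of a point `x` is the law of `(z, l)` for `z` of law `μ` and `l` of law `d(x, z)`. By the
law of large numbers again, the row of `x` at almost all anchors determines its type. By symmetry
of `d`, the law `d(x, x')` is almost surely a function of the types of `x` and `x'`, hence of their
rows: it is the conditional law of the length given the two rows under `pairLaw c`. If two spaces
have the same sampling measure, they have anchors with the same `pairLaw`, and coupling the points
that have equal rows makes the two distance functions agree almost everywhere.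

Conversely, the integrals of products of Lipschitz functions of finitely many entries determine the
sampling measure, and they change by at most a constant times the box distance.
-/

open ProbabilityTheory Filter Topology
open scoped NNReal

section Profile

variable {α : Type*} [MeasurableSpace α] [MeasurableSpace.CountablyGenerated α]

/-- A countable algebra of sets generating the `σ`-algebra of a countably generated space. -/
def countableAlgebra (α : Type*) [MeasurableSpace α] [MeasurableSpace.CountablyGenerated α] :
    Set (Set α) :=
  generateSetAlgebra (MeasurableSpace.countableGeneratingSet α)

instance : Countable (countableAlgebra α) :=
  (countable_generateSetAlgebra MeasurableSpace.countable_countableGeneratingSet).to_subtype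

theorem generateFrom_countableAlgebra :
    MeasurableSpace.generateFrom (countableAlgebra α) = ‹MeasurableSpace α› :=
  generateFrom_generateSetAlgebra_eq.trans MeasurableSpace.generateFrom_countableGeneratingSet

theorem measurableSet_of_mem_countableAlgebra {s : Set α} (hs : s ∈ countableAlgebra α) :
    MeasurableSet s :=
  generateFrom_countableAlgebra (α := α) ▸ MeasurableSpace.measurableSet_generateFrom hs

/-- The values of a measure on the countable generating algebra, as a point of a countable power
of `ℝ≥0∞`. It encodes finite measures by points of a space whose diagonal is measurable. -/
noncomputable def profile (P : Measure α) (s : countableAlgebra α) : ℝ≥0∞ := P s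

theorem measurable_profile : Measurable (profile : Measure α → countableAlgebra α → ℝ≥0∞) :=
  measurable_pi_iff.2 fun s =>
    Measure.measurable_coe (measurableSet_of_mem_countableAlgebra s.2)

theorem eq_of_profile_eq {P Q : Measure α} [IsFiniteMeasure P] (h : profile P = profile Q) :
    P = Q := by
  refine ext_of_generate_finite _ generateFrom_countableAlgebra.symm
    (fun s hs t ht _ => isSetAlgebra_generateSetAlgebra.inter_mem hs ht) ?_ ?_
  · exact fun s hs => congrFun h ⟨s, hs⟩
  · exact congrFun h ⟨_, isSetAlgebra_generateSetAlgebra.univ_mem⟩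

/-- The asymptotic frequencies with which a sequence visits the sets of the countable generating
algebra. -/
noncomputable def empiricalProfile (ω : ℕ → α) (s : countableAlgebra α) : ℝ≥0∞ :=
  limsup (fun n : ℕ =>
    ENNReal.ofReal ((∑ i ∈ Finset.range n, (s : Set α).indicator 1 (ω i)) / n)) atTop

theorem measurable_empiricalProfile :
    Measurable (empiricalProfile : (ℕ → α) → countableAlgebra α → ℝ≥0∞) := by
  refine measurable_pi_iff.2 fun s => Measurable.limsup fun n => ?_
  have hs := measurableSet_of_mem_countableAlgebra s.2
  have (i : ℕ) : Measurable fun ω : ℕ → α => (s : Set α).indicator (1 : α → ℝ) (ω i) :=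
    (measurable_one.indicator hs).comp (measurable_pi_apply i)
  fun_prop

theorem ae_tendsto_average_infinitePi {Ω : Type*} [MeasurableSpace Ω] (P : Measure Ω)
    [IsProbabilityMeasure P] {h : Ω → ℝ} (hm : Measurable h) (hi : Integrable h P) :
    ∀ᵐ ω ∂(Measure.infinitePi fun _ : ℕ => P),
      Tendsto (fun n : ℕ => (∑ i ∈ Finset.range n, h (ω i)) / n) atTop (𝓝 (∫ x, h x ∂P)) := by
  have hmp (i : ℕ) :
      MeasurePreserving (fun ω : ℕ → Ω => ω i) (Measure.infinitePi fun _ : ℕ => P) P :=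
    measurePreserving_eval_infinitePi (fun _ : ℕ => P) i
  have hident (i : ℕ) : IdentDistrib (fun ω : ℕ → Ω => h (ω i)) (fun ω => h (ω 0))
      (Measure.infinitePi fun _ => P) (Measure.infinitePi fun _ => P) :=
    IdentDistrib.comp (u := h) ⟨(hmp i).aemeasurable, (hmp 0).aemeasurable,
      (hmp i).map_eq.trans (hmp 0).map_eq.symm⟩ hm
  have hindep : iIndepFun (fun (i : ℕ) (ω : ℕ → Ω) => h (ω i)) (Measure.infinitePi fun _ => P) :=
    iIndepFun_infinitePi (P := fun _ => P) (X := fun _ => h) fun _ => hm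
  have hmean : ∫ ω, h (ω 0) ∂(Measure.infinitePi fun _ : ℕ => P) = ∫ x, h x ∂P :=
    (hmp 0).hasLaw.integral_comp hm.aestronglyMeasurable
  have hlim := strong_law_ae_real (μ := Measure.infinitePi fun _ : ℕ => P) (fun i ω => h (ω i))
    ((hmp 0).integrable_comp_of_integrable hi) (fun _ _ hij => hindep.indepFun hij) hident
  rwa [hmean] at hlim

theorem ae_empiricalProfile_eq (P : Measure α) [IsProbabilityMeasure P] :
    ∀ᵐ ω ∂(Measure.infinitePi fun _ : ℕ => P), empiricalProfile ω = profile P := by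
  have hfreq : ∀ᵐ ω ∂(Measure.infinitePi fun _ : ℕ => P), ∀ s : countableAlgebra α,
      empiricalProfile ω s = profile P s := by
    refine ae_all_iff.2 fun s => ?_
    have hs := measurableSet_of_mem_countableAlgebra s.2
    filter_upwards [ae_tendsto_average_infinitePi P (measurable_one.indicator hs)
      ((integrable_const (1 : ℝ)).indicator hs)] with ω hω
    rw [integral_indicator_one hs] at hω
    exact (ENNReal.tendsto_ofReal hω).limsup_eq.trans (ofReal_measureReal (measure_ne_top P _))
  filter_upwards [hfreq] with ω hω using funext hω

end Profile

section InfiniteProducts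

variable {A X Y Ω ι : Type*} [MeasurableSpace A] [MeasurableSpace X] [MeasurableSpace Y]
  [MeasurableSpace Ω]

/-- The kernel whose value at `a` is the product of the measures `κ i a`. -/
noncomputable def infinitePiKernel (κ : ι → Kernel A Y) [∀ i, IsMarkovKernel (κ i)] :
    Kernel A (ι → Y) where
  toFun a := Measure.infinitePi fun i => κ i a
  measurable' := by
    refine Measurable.measure_of_isPiSystem_of_isProbabilityMeasure
      generateFrom_squareCylinders.symm
      (isPiSystem_squareCylinders (fun _ => MeasurableSpace.isPiSystem_measurableSet) (by simp)) ?_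
    rintro _ ⟨s, t, ht, rfl⟩
    have ht' (i : ι) : MeasurableSet (t i) := ht i (Set.mem_univ i)
    simp_rw [Measure.infinitePi_pi _ fun i _ => ht' i]
    exact Finset.measurable_prod _ fun i _ => Kernel.measurable_coe _ (ht' i)

theorem infinitePiKernel_apply (κ : ι → Kernel A Y) [∀ i, IsMarkovKernel (κ i)] (a : A) :
    infinitePiKernel κ a = Measure.infinitePi fun i => κ i a := rfl

instance (κ : ι → Kernel A Y) [∀ i, IsMarkovKernel (κ i)] : IsMarkovKernel (infinitePiKernel κ) :=
  ⟨fun a => by rw [infinitePiKernel_apply]; infer_instance⟩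

/-- The product of kernels: given `c`, the coordinates `r i` are independent with laws
`κ i (c i)`. -/
noncomputable def piKernel (κ : ι → Kernel X Y) [∀ i, IsMarkovKernel (κ i)] :
    Kernel (ι → X) (ι → Y) :=
  infinitePiKernel fun i => (κ i).comap (fun c => c i) (measurable_pi_apply i)

instance (κ : ι → Kernel X Y) [∀ i, IsMarkovKernel (κ i)] : IsMarkovKernel (piKernel κ) :=
  inferInstanceAs (IsMarkovKernel (infinitePiKernel _))

theorem map_zip_compProd_piKernel (μ : ι → Measure X) [∀ i, IsProbabilityMeasure (μ i)]
    (κ : ι → Kernel X Y) [∀ i, IsMarkovKernel (κ i)] :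
    (Measure.infinitePi μ ⊗ₘ piKernel κ).map (fun q i => (q.1 i, q.2 i)) =
      Measure.infinitePi fun i => μ i ⊗ₘ κ i := by
  refine Measure.eq_infinitePi _ fun s t ht => ?_
  have hzip : Measurable fun (q : (ι → X) × (ι → Y)) (i : ι) => (q.1 i, q.2 i) := by fun_prop
  have hs : MeasurableSet (Set.pi (s : Set ι) t) := .pi s.countable_toSet fun i _ => ht i
  have hsection (c : ι → X) :
      piKernel κ c (Prod.mk c ⁻¹' ((fun q i => (q.1 i, q.2 i)) ⁻¹' Set.pi (s : Set ι) t)) =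
        ∏ i ∈ s, κ i (c i) (Prod.mk (c i) ⁻¹' t i) :=
    Measure.infinitePi_pi _ fun i _ => measurable_prodMk_left (ht i)
  have hmeas (i : ι) : Measurable fun x => κ i x (Prod.mk x ⁻¹' t i) :=
    Kernel.measurable_kernel_prodMk_left (ht i)
  rw [Measure.map_apply hzip hs, Measure.compProd_apply (hzip hs)]
  simp_rw [hsection]
  rw [lintegral_prod_eq_prod_lintegral_of_indepFun s
    (fun i (c : ι → X) => κ i (c i) (Prod.mk (c i) ⁻¹' t i))
    (iIndepFun_infinitePi (P := μ) hmeas)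
    (fun i => (hmeas i).comp (measurable_pi_apply i))]
  refine Finset.prod_congr rfl fun i _ => ?_
  rw [Measure.compProd_apply (ht i),
    ← (measurePreserving_eval_infinitePi μ i).lintegral_comp (hmeas i)]

theorem map_zip_prod_infinitePi (μ : ι → Measure X) (ν : ι → Measure Y)
    [∀ i, IsProbabilityMeasure (μ i)] [∀ i, IsProbabilityMeasure (ν i)] :
    ((Measure.infinitePi μ).prod (Measure.infinitePi ν)).map (fun q i => (q.1 i, q.2 i)) =
      Measure.infinitePi fun i => (μ i).prod (ν i) := by
  have hconst : piKernel (fun i => Kernel.const X (ν i)) = Kernel.const _ (Measure.infinitePi ν) :=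
    rfl
  have hzip := map_zip_compProd_piKernel μ fun i => Kernel.const X (ν i)
  simpa only [hconst, Measure.compProd_const] using hzip

theorem piKernel_comp_infinitePi (μ : ι → Measure X) [∀ i, IsProbabilityMeasure (μ i)]
    (κ : ι → Kernel X Y) [∀ i, IsMarkovKernel (κ i)] :
    piKernel κ ∘ₘ Measure.infinitePi μ = Measure.infinitePi fun i => κ i ∘ₘ μ i := by
  simp_rw [← Measure.snd_compProd]
  rw [Measure.snd]
  simp_rw [Measure.snd]
  rw [← Measure.infinitePi_map_pi (fun i => μ i ⊗ₘ κ i) fun _ => measurable_snd,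
    ← map_zip_compProd_piKernel, Measure.map_map (by fun_prop) (by fun_prop)]
  rfl

theorem map_sumPiEquivProdPi_infinitePi {J J' : Type*} (P : J ⊕ J' → Measure X)
    [∀ j, IsProbabilityMeasure (P j)] :
    (Measure.infinitePi P).map (MeasurableEquiv.sumPiEquivProdPi fun _ => X) =
      (Measure.infinitePi fun j => P (.inl j)).prod (Measure.infinitePi fun j => P (.inr j)) := by
  rw [MeasurableEquiv.map_apply_eq_iff_map_symm_apply_eq]
  refine (Measure.eq_infinitePi _ fun s t ht => ?_).symm
  have hpre : (MeasurableEquiv.sumPiEquivProdPi fun _ => X).symm ⁻¹' Set.pi (s : Set (J ⊕ J')) t =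
      Set.pi (s.toLeft : Set J) (fun j => t (.inl j)) ×ˢ
        Set.pi (s.toRight : Set J') fun j => t (.inr j) := by
    ext q
    simp [Set.mem_pi, MeasurableEquiv.sumPiEquivProdPi, Equiv.sumPiEquivProdPi]
  rw [MeasurableEquiv.map_apply, hpre, Measure.prod_prod,
    Measure.infinitePi_pi _ fun j _ => ht (.inl j), Measure.infinitePi_pi _ fun j _ => ht (.inr j)]
  conv_rhs => rw [← s.toLeft_disjSum_toRight, Finset.prod_disjSum]

theorem map_prodMk_infinitePi_of_injective {J J' : Type*} (P : ι → Measure X)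
    [∀ i, IsProbabilityMeasure (P i)] {f : J → ι} {g : J' → ι}
    (hfg : Function.Injective (Sum.elim f g)) :
    (Measure.infinitePi P).map (fun u => (fun j => u (f j), fun j => u (g j))) =
      (Measure.infinitePi fun j => P (f j)).prod (Measure.infinitePi fun j => P (g j)) := by
  have hsum := map_sumPiEquivProdPi_infinitePi fun j => P (Sum.elim f g j)
  rw [← Measure.map_infinitePi_infinitePi_of_inj hfg,
    Measure.map_map (MeasurableEquiv.measurable _) (by fun_prop)] at hsum
  exact hsum

theorem map_prodMk_prodMk_infinitePi_of_injective {J J' J'' : Type*} (P : ι → Measure X)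
    [∀ i, IsProbabilityMeasure (P i)] {f : J → ι} {g : J' → ι} {h : J'' → ι}
    (hfgh : Function.Injective (Sum.elim (Sum.elim f g) h)) :
    (Measure.infinitePi P).map
        (fun u => ((fun j => u (f j), fun j => u (g j)), fun j => u (h j))) =
      ((Measure.infinitePi fun j => P (f j)).prod (Measure.infinitePi fun j => P (g j))).prod
        (Measure.infinitePi fun j => P (h j)) := by
  have hsplit := map_prodMk_infinitePi_of_injective P hfgh
  have hsum := map_sumPiEquivProdPi_infinitePi fun j => P (Sum.elim f g j)
  simp only [Sum.elim_inl, Sum.elim_inr] at hsum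
  rw [← hsum, ← Measure.map_id (μ := Measure.infinitePi fun j => P (h j)),
    Measure.map_prod_map _ _ (MeasurableEquiv.measurable _) measurable_id, ← hsplit,
    Measure.map_map (by fun_prop) (by fun_prop)]
  rfl

theorem ae_ae_empiricalProfile_zip_eq [MeasurableSpace.CountablyGenerated (X × Y)] (μ : Measure X)
    [IsProbabilityMeasure μ] (κ : Kernel X Y) [IsMarkovKernel κ] :
    ∀ᵐ c ∂(Measure.infinitePi fun _ : ℕ => μ), ∀ᵐ r ∂(piKernel (fun _ => κ) c),
      empiricalProfile (fun l => (c l, r l)) = profile (μ ⊗ₘ κ) := by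
  have hzip := ae_empiricalProfile_eq (μ ⊗ₘ κ)
  rw [← map_zip_compProd_piKernel] at hzip
  exact Measure.ae_ae_of_ae_compProd (ae_of_ae_map (by fun_prop) hzip)

/-- The law of large numbers recovers the mixed measure from a mixture of i.i.d. sequences. -/
theorem map_empiricalProfile_comp_infinitePiKernel [MeasurableSpace.CountablyGenerated Ω]
    (α : Measure A) (Θ : Kernel A Ω) [IsMarkovKernel Θ] :
    (infinitePiKernel (fun _ : ℕ => Θ) ∘ₘ α).map empiricalProfile =
      α.map fun a => profile (Θ a) := by
  have hprofile : Measurable fun a => profile (Θ a) := measurable_profile.comp Θ.measurable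
  rw [Measure.map_comp _ _ measurable_empiricalProfile,
    ← Measure.deterministic_comp_eq_map hprofile]
  congr 1
  ext1 a
  rw [Kernel.map_apply _ measurable_empiricalProfile, infinitePiKernel_apply,
    Measure.map_congr (ae_empiricalProfile_eq (Θ a)), Measure.map_const]
  simp [Kernel.deterministic_apply]

end InfiniteProducts

section Coupling

variable {X Y Z : Type*} [MeasurableSpace X] [StandardBorelSpace X] [MeasurableSpace Y]
  [StandardBorelSpace Y] [MeasurableSpace Z] [MeasurableEq Z]

theorem ae_condDistrib_id_eq [Nonempty X] (μ : Measure X) [IsProbabilityMeasure μ] {θ : X → Z}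
    (hθ : Measurable θ) : ∀ᵐ t ∂(μ.map θ), ∀ᵐ x ∂(condDistrib id θ μ t), θ x = t := by
  refine Measure.ae_ae_of_ae_compProd (p := fun q : Z × X => θ q.2 = q.1) ?_
  rw [compProd_map_condDistrib aemeasurable_id,
    ae_map_iff (by fun_prop) (measurableSet_eq_fun (by fun_prop) (by fun_prop))]
  simp

theorem exists_coupling_of_map_eq (μ : Measure X) [IsProbabilityMeasure μ] (ν : Measure Y)
    [IsProbabilityMeasure ν] {φ : X → Z} {ψ : Y → Z} (hφ : Measurable φ) (hψ : Measurable ψ)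
    (h : μ.map φ = ν.map ψ) :
    ∃ π : Measure (X × Y), IsProbabilityMeasure π ∧ π.map Prod.fst = μ ∧ π.map Prod.snd = ν ∧
      ∀ᵐ p ∂π, φ p.1 = ψ p.2 := by
  have : Nonempty X := nonempty_of_isProbabilityMeasure μ
  have : Nonempty Y := nonempty_of_isProbabilityMeasure ν
  have : IsProbabilityMeasure (μ.map φ) := Measure.isProbabilityMeasure_map hφ.aemeasurable
  refine ⟨(condDistrib id φ μ ×ₖ condDistrib id ψ ν) ∘ₘ (μ.map φ), inferInstance, ?_, ?_, ?_⟩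
  · rw [Measure.map_comp _ _ measurable_fst, ← Kernel.fst_eq, Kernel.fst_prod,
      condDistrib_comp_map hφ.aemeasurable aemeasurable_id, Measure.map_id]
  · rw [Measure.map_comp _ _ measurable_snd, ← Kernel.snd_eq, Kernel.snd_prod, h,
      condDistrib_comp_map hψ.aemeasurable aemeasurable_id, Measure.map_id]
  · refine Measure.ae_comp_of_ae_ae (measurableSet_eq_fun (by fun_prop) (by fun_prop)) ?_
    filter_upwards [ae_condDistrib_id_eq μ hφ, h ▸ ae_condDistrib_id_eq ν hψ] with t hfst hsnd
    rw [Kernel.prod_apply]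
    filter_upwards [Measure.quasiMeasurePreserving_fst.ae hfst,
      Measure.quasiMeasurePreserving_snd.ae hsnd] with p hp₁ hp₂
    rw [hp₁, hp₂]

end Coupling

section RowType

variable {X Y Z E : Type*} [MeasurableSpace X] [MeasurableSpace Y] [MeasurableSpace Z]
  [MeasurableSpace E]

theorem measurableSet_setOf_kernel_eq [MeasurableSpace.CountablyGenerated E] (κ η : Kernel X E)
    [IsFiniteKernel κ] : MeasurableSet {x | κ x = η x} := by
  have heq : {x | κ x = η x} = {x | profile (κ x) = profile (η x)} :=
    Set.ext fun x => ⟨congrArg profile, eq_of_profile_eq⟩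
  rw [heq]
  exact measurableSet_eq_fun (measurable_profile.comp κ.measurable)
    (measurable_profile.comp η.measurable)

theorem comp_eq_of_ae_eq (κ : Kernel X E) (μ : Measure X) [IsProbabilityMeasure μ] {P : Measure E}
    (h : ∀ᵐ x ∂μ, κ x = P) : κ ∘ₘ μ = P :=
  (Measure.comp_congr (η := Kernel.const X P) h).trans (by simp)

theorem const_compProd_comp_parallelComp (K : Kernel Z X) [IsSFiniteKernel K] (μ : Measure Y)
    [SFinite μ] (κ : Kernel (X × Y) E) [IsSFiniteKernel κ] :
    Kernel.const Z μ ⊗ₖ (κ ∘ₖ (K ∥ₖ Kernel.id)) = (Kernel.const X μ ⊗ₖ κ) ∘ₖ K := by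
  ext1 t
  refine Measure.ext_of_lintegral _ fun f hf => ?_
  have hf' (y : Y) : Measurable fun e => f (y, e) := hf.comp measurable_prodMk_left
  have hκ : Measurable fun p : X × Y => ∫⁻ e, f (p.2, e) ∂κ p :=
    Measurable.lintegral_kernel_prod_right' (f := fun q : (X × Y) × E => f (q.1.2, q.2))
      (hf.comp (by fun_prop))
  have hmix (y : Y) : ∫⁻ e, f (y, e) ∂(κ ∘ₖ (K ∥ₖ Kernel.id)) (t, y) =
      ∫⁻ x, ∫⁻ e, f (y, e) ∂κ (x, y) ∂K t := by
    have hκ' : Measurable fun p => ∫⁻ e, f (y, e) ∂κ p := (hf' y).lintegral_kernel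
    rw [Kernel.lintegral_comp _ _ _ (hf' y), Kernel.parallelComp_apply, Kernel.id_apply,
      lintegral_prod _ hκ'.aemeasurable]
    exact lintegral_congr fun x => lintegral_dirac' _ (hκ'.comp measurable_prodMk_left)
  rw [Kernel.lintegral_compProd _ _ _ hf, Kernel.lintegral_comp _ _ _ hf]
  simp_rw [hmix, Kernel.lintegral_compProd _ _ _ hf, Kernel.const_apply]
  exact lintegral_lintegral_swap (hκ.comp measurable_swap).aemeasurable

theorem ae_ae_condDistrib_id [StandardBorelSpace X] [Nonempty X] (μ : Measure X)
    [IsProbabilityMeasure μ] {θ : X → Z} (hθ : Measurable θ) {p : X → Prop}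
    (hp : ∀ᵐ x ∂μ, p x) : ∀ᵐ x ∂μ, ∀ᵐ x' ∂(condDistrib id θ μ (θ x)), p x' := by
  refine ae_of_ae_map hθ.aemeasurable (p := fun t => ∀ᵐ x' ∂(condDistrib id θ μ t), p x') ?_
  refine Measure.ae_ae_of_ae_comp (μ := μ.map θ) ?_
  rwa [condDistrib_comp_map hθ.aemeasurable aemeasurable_id, Measure.map_id]

/-- The type of `x`: the law of `(z, e)` for `z` of law `μ` and then `e` of law `κ (x, z)`,
encoded by its profile. -/
noncomputable def rowType [MeasurableSpace.CountablyGenerated (Y × E)] (μ : Measure Y)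
    (κ : Kernel (X × Y) E) (x : X) : countableAlgebra (Y × E) → ℝ≥0∞ :=
  profile ((Kernel.const X μ ⊗ₖ κ) x)

theorem measurable_rowType [MeasurableSpace.CountablyGenerated (Y × E)] (μ : Measure Y)
    (κ : Kernel (X × Y) E) : Measurable (rowType μ κ) :=
  measurable_profile.comp (Kernel.measurable _)

variable [StandardBorelSpace X] [StandardBorelSpace E] (μ : Measure X) [IsProbabilityMeasure μ]
  (κ : Kernel (X × X) E) [IsMarkovKernel κ]

/-- A point may be replaced by a random point of the same type. -/
theorem ae_eq_comp_condDistrib_rowType [Nonempty X] : ∀ᵐ x ∂μ, ∀ᵐ z ∂μ,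
    κ (x, z) = (κ ∘ₖ (condDistrib id (rowType μ κ) μ ∥ₖ Kernel.id)) (rowType μ κ x, z) := by
  set T := rowType μ κ
  set K := condDistrib id T μ
  have hT : Measurable T := measurable_rowType μ κ
  filter_upwards [ae_of_ae_map hT.aemeasurable (ae_condDistrib_id_eq μ hT)] with x hx
  have hrow : (Kernel.const _ μ ⊗ₖ (κ ∘ₖ (K ∥ₖ Kernel.id))) (T x) = (Kernel.const X μ ⊗ₖ κ) x := by
    rw [const_compProd_comp_parallelComp, Kernel.comp_apply]
    refine comp_eq_of_ae_eq _ _ ?_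
    filter_upwards [hx] with x' hx' using eq_of_profile_eq hx'
  rw [Kernel.compProd_apply_eq_compProd_sectR, Kernel.compProd_apply_eq_compProd_sectR,
    Kernel.const_apply, Kernel.const_apply] at hrow
  filter_upwards [Kernel.ae_eq_of_compProd_eq hrow] with z hz using by simpa using hz.symm

/-- By symmetry, replacing one argument by a random point of the same type can be carried over to
the other argument, so both arguments may be replaced. -/
theorem exists_ae_eq_comp_rowType (hsymm : ∀ x z, κ (x, z) = κ (z, x)) :
    ∃ V : Kernel ((countableAlgebra (X × E) → ℝ≥0∞) × (countableAlgebra (X × E) → ℝ≥0∞)) E,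
      IsMarkovKernel V ∧ ∀ᵐ p ∂(μ.prod μ), κ p = V (rowType μ κ p.1, rowType μ κ p.2) := by
  have : Nonempty X := nonempty_of_isProbabilityMeasure μ
  set T := rowType μ κ
  set K := condDistrib id T μ
  have hT : Measurable T := measurable_rowType μ κ
  set U := κ ∘ₖ (K ∥ₖ Kernel.id)
  set V := U ∘ₖ (Kernel.id ∥ₖ K)
  have hmeas (η : Kernel (X × X) E) : MeasurableSet {p | κ p = η p} :=
    measurableSet_setOf_kernel_eq κ η
  have hU : ∀ᵐ x ∂μ, ∀ᵐ z ∂μ, κ (x, z) = U (T x, z) := ae_eq_comp_condDistrib_rowType μ κ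
  have hU' : ∀ᵐ x ∂μ, ∀ᵐ z ∂μ, κ (x, z) = U (T z, x) := by
    filter_upwards [(Measure.ae_ae_comm (hmeas (U.comap (Prod.map T id) (by fun_prop)))).1 hU]
      with x hx
    filter_upwards [hx] with z hz using (hsymm x z).trans hz
  refine ⟨V, inferInstance, ?_⟩
  refine (Measure.ae_prod_iff_ae_ae (hmeas (V.comap (Prod.map T T) (by fun_prop)))).2 ?_
  have hfiber := ae_of_ae_map hT.aemeasurable (ae_condDistrib_id_eq μ hT)
  filter_upwards [hU, hU'] with x hx hx'
  filter_upwards [hx', hfiber, ae_ae_condDistrib_id μ hT hx, ae_ae_condDistrib_id μ hT hx']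
    with z hz hzT hzU hzU'
  have hV : V (T x, T z) = U.sectR (T x) ∘ₘ K (T z) := by
    rw [Kernel.comp_apply, Kernel.parallelComp_apply, Kernel.id_apply, Measure.dirac_prod,
      ← Measure.deterministic_comp_eq_map measurable_prodMk_left, Measure.comp_assoc,
      Kernel.comp_deterministic_eq_comap]
    rfl
  rw [Kernel.comap_apply, Prod.map_apply, hV, eq_comm]
  refine comp_eq_of_ae_eq _ _ ?_
  filter_upwards [hzT, hzU, hzU'] with z' hT' hU₁ hU₂
  rw [Kernel.sectR_apply, ← hU₁, hU₂, hT', hz]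

end RowType

section Anchors

variable {A B X E : Type*} [MeasurableSpace A] [MeasurableSpace B] [MeasurableSpace X]
  [MeasurableSpace E]

theorem map_compProd_comap (ξ : Measure A) [SFinite ξ] (W : Kernel B E) [IsSFiniteKernel W]
    {φ : A → B} (hφ : Measurable φ) :
    (ξ ⊗ₘ W.comap φ hφ).map (Prod.map φ id) = ξ.map φ ⊗ₘ W := by
  refine Measure.ext_of_lintegral _ fun f hf => ?_
  rw [lintegral_map hf (by fun_prop), Measure.lintegral_compProd (by fun_prop),
    Measure.lintegral_compProd hf, lintegral_map hf.lintegral_kernel_prod_right' hφ]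
  rfl

theorem comp_id_prod_const_apply (κ : Kernel (A × B) E) (β : Measure B) [SFinite β] (a : A) :
    (κ ∘ₖ (Kernel.id ×ₖ Kernel.const A β)) a = κ.sectR a ∘ₘ β := by
  rw [Kernel.comp_apply, Kernel.prod_apply, Kernel.id_apply, Kernel.const_apply,
    Measure.dirac_prod, ← Measure.deterministic_comp_eq_map measurable_prodMk_left,
    Measure.comp_assoc, Kernel.comp_deterministic_eq_comap]
  rfl

theorem ae_eq_condKernel_of_eq_map [StandardBorelSpace E] [Nonempty E] (ξ : Measure A)
    [IsProbabilityMeasure ξ] (κ : Kernel A E) [IsMarkovKernel κ] (W : Kernel B E)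
    [IsMarkovKernel W] {φ : A → B} (hφ : Measurable φ) (h : ∀ᵐ a ∂ξ, κ a = W (φ a))
    {P : Measure (B × E)} [IsFiniteMeasure P] (hP : P = (ξ ⊗ₘ κ).map (Prod.map φ id)) :
    ∀ᵐ a ∂ξ, κ a = P.condKernel (φ a) := by
  have hW : P = ξ.map φ ⊗ₘ W := by
    rw [hP, Measure.compProd_congr (η := W.comap φ hφ) h, map_compProd_comap]
  have hfst : P.fst = ξ.map φ := by rw [hW, Measure.fst_compProd]
  have hcond := eq_condKernel_of_measure_eq_compProd W (hfst ▸ hW)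
  rw [hfst] at hcond
  filter_upwards [h, ae_of_ae_map hφ.aemeasurable hcond]
    with a hκW hWP using hκW.trans hWP

/-- The law of the row of a point `x` at the anchors `c`: its entries are independent with laws
`κ (x, c l)`. -/
noncomputable def rowKernel (κ : Kernel (X × X) E) [IsMarkovKernel κ] :
    Kernel ((ℕ → X) × X) (ℕ → E) :=
  infinitePiKernel fun l => κ.comap (fun q : (ℕ → X) × X => (q.2, q.1 l)) (by fun_prop)

instance (κ : Kernel (X × X) E) [IsMarkovKernel κ] : IsMarkovKernel (rowKernel κ) :=
  inferInstanceAs (IsMarkovKernel (infinitePiKernel _))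

/-- The joint law of a random point and of its row at the anchors. -/
noncomputable def rowLaw (μ : Measure X) (κ : Kernel (X × X) E) [IsMarkovKernel κ] :
    Kernel (ℕ → X) (X × (ℕ → E)) :=
  Kernel.const _ μ ⊗ₖ rowKernel κ

instance (μ : Measure X) [IsProbabilityMeasure μ] (κ : Kernel (X × X) E) [IsMarkovKernel κ] :
    IsMarkovKernel (rowLaw μ κ) :=
  inferInstanceAs (IsMarkovKernel (_ ⊗ₖ _))

/-- Given the anchors `c` and the points `x`, `x'`: the rows of `x` and `x'` at the anchors, and an
entry of law `κ (x, x')`, all independent. -/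
noncomputable def pairKernel (κ : Kernel (X × X) E) [IsMarkovKernel κ] :
    Kernel ((ℕ → X) × X × X) (((ℕ → E) × (ℕ → E)) × E) :=
  ((rowKernel κ).comap (fun q => (q.1, q.2.1)) (by fun_prop) ×ₖ
    (rowKernel κ).comap (fun q => (q.1, q.2.2)) (by fun_prop)) ×ₖ κ.comap Prod.snd measurable_snd

instance (κ : Kernel (X × X) E) [IsMarkovKernel κ] : IsMarkovKernel (pairKernel κ) :=
  inferInstanceAs (IsMarkovKernel ((_ ×ₖ _) ×ₖ _))

theorem pairKernel_apply (κ : Kernel (X × X) E) [IsMarkovKernel κ] (c : ℕ → X) (x x' : X) :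
    pairKernel κ (c, x, x') =
      ((rowKernel κ (c, x)).prod (rowKernel κ (c, x'))).prod (κ (x, x')) := by
  simp [pairKernel, Kernel.prod_apply]

/-- The mixture of `pairKernel κ (c, x, x')` over independent `x`, `x'` of law `μ`. -/
noncomputable def pairLaw (μ : Measure X) (κ : Kernel (X × X) E) [IsMarkovKernel κ] :
    Kernel (ℕ → X) (((ℕ → E) × (ℕ → E)) × E) :=
  pairKernel κ ∘ₖ (Kernel.id ×ₖ Kernel.const _ (μ.prod μ))

variable (μ : Measure X) [IsProbabilityMeasure μ] (κ : Kernel (X × X) E) [IsMarkovKernel κ]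

instance : IsMarkovKernel (pairLaw μ κ) :=
  inferInstanceAs (IsMarkovKernel (_ ∘ₖ _))

theorem rowLaw_apply (c : ℕ → X) : rowLaw μ κ c = μ ⊗ₘ (rowKernel κ).sectR c := by
  rw [rowLaw, Kernel.compProd_apply_eq_compProd_sectR, Kernel.const_apply]

theorem fst_rowLaw (c : ℕ → X) : (rowLaw μ κ c).fst = μ := by
  rw [rowLaw_apply, Measure.fst_compProd]

theorem pairLaw_apply (c : ℕ → X) : pairLaw μ κ c = (pairKernel κ).sectR c ∘ₘ μ.prod μ :=
  comp_id_prod_const_apply _ _ c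

theorem rowKernel_apply_eq_piKernel_sectR (c : ℕ → X) (x : X) :
    rowKernel κ (c, x) = piKernel (fun _ => κ.sectR x) c := rfl

theorem ae_ae_empiricalProfile_rowKernel_eq [MeasurableSpace.CountablyGenerated (X × E)] (x : X) :
    ∀ᵐ c ∂(Measure.infinitePi fun _ : ℕ => μ), ∀ᵐ r ∂(rowKernel κ (c, x)),
      empiricalProfile (fun l => (c l, r l)) = rowType μ κ x := by
  simp only [rowKernel_apply_eq_piKernel_sectR]
  rw [rowType, Kernel.compProd_apply_eq_compProd_sectR, Kernel.const_apply]
  exact ae_ae_empiricalProfile_zip_eq μ (κ.sectR x)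

theorem ae_ae_empiricalProfile_rowLaw_eq [MeasurableSpace.CountablyGenerated (X × E)] :
    ∀ᵐ c ∂(Measure.infinitePi fun _ : ℕ => μ), ∀ᵐ p ∂(rowLaw μ κ c),
      empiricalProfile (fun l => (c l, p.2 l)) = rowType μ κ p.1 := by
  have hset : MeasurableSet {q : ((ℕ → X) × X) × (ℕ → E) |
      empiricalProfile (fun l => (q.1.1 l, q.2 l)) = rowType μ κ q.1.2} :=
    measurableSet_eq_fun (measurable_empiricalProfile.comp (by fun_prop))
      ((measurable_rowType μ κ).comp (by fun_prop))
  have hset' : MeasurableSet {q : (ℕ → X) × X | ∀ᵐ r ∂(rowKernel κ q),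
      empiricalProfile (fun l => (q.1 l, r l)) = rowType μ κ q.2} :=
    Kernel.measurable_kernel_prodMk_left hset.compl (measurableSet_singleton 0)
  have hswap : ∀ᵐ c ∂(Measure.infinitePi fun _ : ℕ => μ), ∀ᵐ x ∂μ, ∀ᵐ r ∂(rowKernel κ (c, x)),
      empiricalProfile (fun l => (c l, r l)) = rowType μ κ x :=
    (Measure.ae_ae_comm hset').2 (ae_of_all μ (ae_ae_empiricalProfile_rowKernel_eq μ κ))
  filter_upwards [hswap] with c hc
  have hset_c : MeasurableSet {p : X × (ℕ → E) |
      empiricalProfile (fun l => (c l, p.2 l)) = rowType μ κ p.1} :=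
    hset.preimage (f := fun p : X × (ℕ → E) => ((c, p.1), p.2)) (by fun_prop)
  rw [rowLaw_apply]
  exact (Measure.ae_compProd_iff hset_c).2 hc

theorem rowLaw_prod_rowLaw (c : ℕ → X) : (rowLaw μ κ c).prod (rowLaw μ κ c) =
    ((Kernel.id ×ₖ (rowKernel κ).sectR c) ∥ₖ (Kernel.id ×ₖ (rowKernel κ).sectR c)) ∘ₘ
      μ.prod μ := by
  rw [rowLaw_apply, Measure.compProd_eq_comp_prod, Measure.prod_comp_left, Measure.prod_comp_right,
    Measure.comp_assoc, Kernel.parallelComp_comp_parallelComp, Kernel.comp_id, Kernel.id_comp]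

theorem pairLaw_eq_map_compProd (c : ℕ → X) :
    pairLaw μ κ c = (((rowLaw μ κ c).prod (rowLaw μ κ c)) ⊗ₘ
      κ.comap (fun p => (p.1.1, p.2.1)) (by fun_prop)).map
        (Prod.map (Prod.map Prod.snd Prod.snd) id) := by
  set κ' : Kernel ((X × (ℕ → E)) × (X × (ℕ → E))) E :=
    κ.comap (fun p => (p.1.1, p.2.1)) (by fun_prop)
  have hforget : Measurable (Prod.map (Prod.map Prod.snd Prod.snd) id :
    ((X × (ℕ → E)) × (X × (ℕ → E))) × E → ((ℕ → E) × (ℕ → E)) × E) := by fun_prop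
  rw [pairLaw_apply, rowLaw_prod_rowLaw, Measure.compProd_eq_comp_prod, Measure.comp_assoc,
    Measure.map_comp _ _ hforget]
  congr 1
  ext1 p
  obtain ⟨x, x'⟩ := p
  set φ : (ℕ → E) × (ℕ → E) → (X × (ℕ → E)) × (X × (ℕ → E)) :=
    Prod.map (Prod.mk x) (Prod.mk x')
  have hφ : Measurable φ := by fun_prop
  have hκ' : κ'.comap φ hφ = Kernel.const _ (κ (x, x')) := rfl
  rw [Kernel.map_apply _ hforget, Kernel.comp_apply, Kernel.parallelComp_apply, Kernel.prod_apply,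
    Kernel.prod_apply, Kernel.id_apply, Kernel.id_apply, Measure.dirac_prod, Measure.dirac_prod,
    Measure.map_prod_map _ _ measurable_prodMk_left measurable_prodMk_left,
    ← Measure.compProd_eq_comp_prod, ← map_compProd_comap _ _ hφ, hκ', Measure.compProd_const,
    Measure.map_map hforget (by fun_prop)]
  exact (pairKernel_apply κ c x x').trans Measure.map_id.symm

theorem snd_rowLaw (c : ℕ → X) : (rowLaw μ κ c).snd = (pairLaw μ κ c).fst.fst := by
  set ξ := rowLaw μ κ c
  set κ' : Kernel ((X × (ℕ → E)) × (X × (ℕ → E))) E :=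
    κ.comap (fun p => (p.1.1, p.2.1)) (by fun_prop)
  calc ξ.snd = ((ξ.prod ξ ⊗ₘ κ').fst.fst).snd := by rw [Measure.fst_compProd, Measure.fst_prod]
    _ = (((ξ.prod ξ ⊗ₘ κ').map (Prod.map (Prod.map Prod.snd Prod.snd) id)).fst).fst := by
      simp only [Measure.fst, Measure.snd]
      rw [Measure.map_map (by fun_prop) (by fun_prop), Measure.map_map (by fun_prop) (by fun_prop),
        Measure.map_map (by fun_prop) (by fun_prop), Measure.map_map (by fun_prop) (by fun_prop)]
      rfl
    _ = (pairLaw μ κ c).fst.fst := by rw [pairLaw_eq_map_compProd]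

theorem ae_ae_eq_condKernel_pairLaw [StandardBorelSpace X] [StandardBorelSpace E] [Nonempty E]
    (hsymm : ∀ x z, κ (x, z) = κ (z, x)) :
    ∀ᵐ c ∂(Measure.infinitePi fun _ : ℕ => μ), ∀ᵐ p ∂((rowLaw μ κ c).prod (rowLaw μ κ c)),
      κ (p.1.1, p.2.1) = (pairLaw μ κ c).condKernel (p.1.2, p.2.2) := by
  obtain ⟨V, _, hV⟩ := exists_ae_eq_comp_rowType μ κ hsymm
  filter_upwards [ae_ae_empiricalProfile_rowLaw_eq μ κ] with c hc
  set ξ := rowLaw μ κ c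
  have hrow : Measurable fun r : ℕ → E => empiricalProfile fun l => (c l, r l) :=
    measurable_empiricalProfile.comp (by fun_prop)
  have hfst : MeasurePreserving Prod.fst ξ μ := ⟨measurable_fst, fst_rowLaw μ κ c⟩
  have hrows : Measurable fun r : (ℕ → E) × (ℕ → E) =>
      (empiricalProfile fun l => (c l, r.1 l), empiricalProfile fun l => (c l, r.2 l)) :=
    (hrow.comp measurable_fst).prodMk (hrow.comp measurable_snd)
  have hVrow : ∀ᵐ p ∂(ξ.prod ξ), κ (p.1.1, p.2.1) = V.comap
      (fun r : (ℕ → E) × (ℕ → E) => (empiricalProfile fun l => (c l, r.1 l),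
        empiricalProfile fun l => (c l, r.2 l))) hrows (p.1.2, p.2.2) := by
    filter_upwards [(hfst.prod hfst).quasiMeasurePreserving.ae hV,
      Measure.quasiMeasurePreserving_fst.ae hc, Measure.quasiMeasurePreserving_snd.ae hc]
      with p hp hp₁ hp₂
    rw [Kernel.comap_apply, hp₁, hp₂]
    exact hp
  exact ae_eq_condKernel_of_eq_map (ξ.prod ξ) (κ.comap (fun p => (p.1.1, p.2.1)) (by fun_prop)) _
    (φ := Prod.map Prod.snd Prod.snd) (by fun_prop) hVrow (pairLaw_eq_map_compProd μ κ c)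

end Anchors

section SampleLaw

open QMMSpace (Pairs)

variable {X E : Type*} [MeasurableSpace X] [MeasurableSpace E]

/-- Given the points `x i`, independent entries of laws `κ (x i, x j)` for `i < j`. -/
noncomputable def sampleKernel (κ : Kernel (X × X) E) [IsMarkovKernel κ] :
    Kernel (ℕ → X) (Pairs → E) :=
  infinitePiKernel fun p => κ.comap (fun x : ℕ → X => (x p.1.1, x p.1.2)) (by fun_prop)

instance (κ : Kernel (X × X) E) [IsMarkovKernel κ] : IsMarkovKernel (sampleKernel κ) :=
  inferInstanceAs (IsMarkovKernel (infinitePiKernel _))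

/-- The law of the entries above the diagonal of the random matrix sampled from `(μ, κ)`: the
entries are conditionally independent given independent points of law `μ`. -/
noncomputable def sampleLaw (μ : Measure X) (κ : Kernel (X × X) E) [IsMarkovKernel κ] :
    Measure (Pairs → E) :=
  sampleKernel κ ∘ₘ (Measure.infinitePi fun _ : ℕ => μ)

instance (μ : Measure X) [IsProbabilityMeasure μ] (κ : Kernel (X × X) E) [IsMarkovKernel κ] :
    IsProbabilityMeasure (sampleLaw μ κ) :=
  inferInstanceAs (IsProbabilityMeasure (_ ∘ₘ _))

theorem sampleKernel_apply (κ : Kernel (X × X) E) [IsMarkovKernel κ] (x : ℕ → X) :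
    sampleKernel κ x = Measure.infinitePi fun p : Pairs => κ (x p.1.1, x p.1.2) := rfl

/-- The position above the diagonal of the entry `(i, j)` of a symmetric matrix. -/
def sortedPair (i j : ℕ) (hij : i ≠ j) : Pairs := ⟨(min i j, max i j), min_lt_max.2 hij⟩

theorem sortedPair_eq_sortedPair_iff {i j i' j' : ℕ} {hij : i ≠ j} {hij' : i' ≠ j'} :
    sortedPair i j hij = sortedPair i' j' hij' ↔ i = i' ∧ j = j' ∨ i = j' ∧ j = i' := by
  simp only [sortedPair, Subtype.mk.injEq, Prod.mk.injEq]
  omega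

theorem apply_sortedPair {κ : Kernel (X × X) E} (hsymm : ∀ x z, κ (x, z) = κ (z, x)) (x : ℕ → X)
    (i j : ℕ) (hij : i ≠ j) :
    κ (x (sortedPair i j hij).1.1, x (sortedPair i j hij).1.2) = κ (x i, x j) := by
  rcases hij.lt_or_gt with h | h
  · simp only [sortedPair, min_eq_left h.le, max_eq_right h.le]
  · simp only [sortedPair, min_eq_right h.le, max_eq_left h.le, hsymm (x j)]

/-- The entries of a sampled matrix, read in blocks: the indices `3l` are the anchors, and the
`k`-th block consists of the rows of the indices `3k+1` and `3k+2` at the anchors, and of the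
entry `(3k+1, 3k+2)`. -/
def blocks (u : Pairs → E) (k : ℕ) : ((ℕ → E) × (ℕ → E)) × E :=
  ((fun l => u (sortedPair (3 * k + 1) (3 * l) (by omega)),
    fun l => u (sortedPair (3 * k + 2) (3 * l) (by omega))),
    u (sortedPair (3 * k + 1) (3 * k + 2) (by omega)))

theorem measurable_blocks : Measurable (blocks : (Pairs → E) → ℕ → ((ℕ → E) × (ℕ → E)) × E) := by
  unfold blocks
  fun_prop

theorem map_blocks_infinitePi (P : Pairs → Measure E) [∀ p, IsProbabilityMeasure (P p)] :
    (Measure.infinitePi P).map blocks = Measure.infinitePi fun k =>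
      ((Measure.infinitePi fun l => P (sortedPair (3 * k + 1) (3 * l) (by omega))).prod
        (Measure.infinitePi fun l => P (sortedPair (3 * k + 2) (3 * l) (by omega)))).prod
        (P (sortedPair (3 * k + 1) (3 * k + 2) (by omega))) := by
  set f : ℕ × ℕ → Pairs := fun q => sortedPair (3 * q.1 + 1) (3 * q.2) (by omega)
  set g : ℕ × ℕ → Pairs := fun q => sortedPair (3 * q.1 + 2) (3 * q.2) (by omega)
  set h : ℕ → Pairs := fun k => sortedPair (3 * k + 1) (3 * k + 2) (by omega)
  have hinj : Function.Injective (Sum.elim (Sum.elim f g) h) := by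
    rintro ((⟨k, l⟩ | ⟨k, l⟩) | k) ((⟨k', l'⟩ | ⟨k', l'⟩) | k') heq <;>
      simp only [Sum.elim_inl, Sum.elim_inr, f, g, h, sortedPair_eq_sortedPair_iff] at heq <;>
      first
        | omega
        | simp only [Sum.inl.injEq, Sum.inr.injEq, Prod.mk.injEq]; omega
  rw [← map_zip_prod_infinitePi
      (fun k => (Measure.infinitePi fun l => P (f (k, l))).prod
        (Measure.infinitePi fun l => P (g (k, l)))) fun k => P (h k),
    ← map_zip_prod_infinitePi (fun k => Measure.infinitePi fun l => P (f (k, l)))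
      fun k => Measure.infinitePi fun l => P (g (k, l)),
    ← Measure.infinitePi_map_curry fun k l => P (f (k, l)),
    ← Measure.infinitePi_map_curry fun k l => P (g (k, l)),
    Measure.map_prod_map _ _ (MeasurableEquiv.measurable _) (MeasurableEquiv.measurable _),
    Measure.map_map (by fun_prop) (by fun_prop),
    ← Measure.map_id (μ := Measure.infinitePi fun k => P (h k)),
    Measure.map_prod_map _ _ (by fun_prop) measurable_id,
    Measure.map_map (by fun_prop) (by fun_prop),
    ← map_prodMk_prodMk_infinitePi_of_injective P hinj,
    Measure.map_map (by fun_prop) (by fun_prop)]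
  rfl

theorem map_sampleKernel_blocks (κ : Kernel (X × X) E) [IsMarkovKernel κ]
    (hsymm : ∀ x z, κ (x, z) = κ (z, x)) (x : ℕ → X) :
    (sampleKernel κ x).map blocks = Measure.infinitePi fun k =>
      pairKernel κ (fun l => x (3 * l), x (3 * k + 1), x (3 * k + 2)) := by
  rw [sampleKernel_apply, map_blocks_infinitePi]
  congr 1
  funext k
  simp only [apply_sortedPair hsymm]
  exact (pairKernel_apply κ _ _ _).symm

/-- The conditional law of the blocks given the anchors and the pairs of points of the blocks. -/
noncomputable def blockKernel (κ : Kernel (X × X) E) [IsMarkovKernel κ] :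
    Kernel ((ℕ → X) × (ℕ → X × X)) (ℕ → ((ℕ → E) × (ℕ → E)) × E) :=
  infinitePiKernel fun k => (pairKernel κ).comap
    (fun q : (ℕ → X) × (ℕ → X × X) => (q.1, q.2 k)) (by fun_prop)

variable (μ : Measure X) [IsProbabilityMeasure μ]

theorem blockKernel_comp_prod (κ : Kernel (X × X) E) [IsMarkovKernel κ] :
    blockKernel κ ∘ₘ (Measure.infinitePi fun _ : ℕ => μ).prod
      (Measure.infinitePi fun _ => μ.prod μ) =
      infinitePiKernel (fun _ : ℕ => pairLaw μ κ) ∘ₘ (Measure.infinitePi fun _ : ℕ => μ) := by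
  rw [← Measure.compProd_const, Measure.compProd_eq_comp_prod, Measure.comp_assoc]
  congr 1
  ext1 c
  rw [comp_id_prod_const_apply, infinitePiKernel_apply]
  simp only [pairLaw_apply]
  exact piKernel_comp_infinitePi (fun _ : ℕ => μ.prod μ) fun _ => (pairKernel κ).sectR c

theorem map_points_infinitePi :
    (Measure.infinitePi fun _ : ℕ => μ).map
      (fun x => ((fun l => x (3 * l)), fun k => (x (3 * k + 1), x (3 * k + 2)))) =
      (Measure.infinitePi fun _ => μ).prod (Measure.infinitePi fun _ => μ.prod μ) := by
  have hinj : Function.Injective (Sum.elim (fun l : ℕ => 3 * l)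
      (Sum.elim (fun k => 3 * k + 1) fun k => 3 * k + 2)) := by
    rintro (l | k | k) (l' | k' | k') heq <;> simp only [Sum.elim_inl, Sum.elim_inr] at heq <;>
      first
        | omega
        | simp only [Sum.inl.injEq, Sum.inr.injEq]; omega
  rw [← map_zip_prod_infinitePi (fun _ => μ) fun _ => μ,
    ← map_sumPiEquivProdPi_infinitePi fun _ : ℕ ⊕ ℕ => μ,
    Measure.map_map (by fun_prop) (MeasurableEquiv.measurable _),
    ← Measure.map_id (μ := Measure.infinitePi fun _ => μ),
    Measure.map_prod_map _ _ measurable_id (by fun_prop), Measure.map_id,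
    ← map_prodMk_infinitePi_of_injective (fun _ => μ) hinj,
    Measure.map_map (by fun_prop) (by fun_prop)]
  rfl

theorem map_blocks_sampleLaw (κ : Kernel (X × X) E) [IsMarkovKernel κ]
    (hsymm : ∀ x z, κ (x, z) = κ (z, x)) :
    (sampleLaw μ κ).map blocks =
      infinitePiKernel (fun _ : ℕ => pairLaw μ κ) ∘ₘ (Measure.infinitePi fun _ : ℕ => μ) := by
  have hpoints : Measurable fun x : ℕ → X =>
    ((fun l => x (3 * l)), fun k => (x (3 * k + 1), x (3 * k + 2))) := by fun_prop
  rw [← blockKernel_comp_prod, ← map_points_infinitePi,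
    ← Measure.deterministic_comp_eq_map hpoints, Measure.comp_assoc,
    Kernel.comp_deterministic_eq_comap, sampleLaw, Measure.map_comp _ _ measurable_blocks]
  congr 1
  ext1 x
  rw [Kernel.map_apply _ measurable_blocks, map_sampleKernel_blocks κ hsymm, Kernel.comap_apply]
  rfl

end SampleLaw

section Reconstruction

variable {X Y E : Type*} [MeasurableSpace X] [MeasurableSpace Y] [MeasurableSpace E]
  [StandardBorelSpace E]
  (μ : Measure X) [IsProbabilityMeasure μ] (κ : Kernel (X × X) E) [IsMarkovKernel κ]
  (ν : Measure Y) [IsProbabilityMeasure ν] (η : Kernel (Y × Y) E) [IsMarkovKernel η]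

theorem map_profile_pairLaw_eq (hκ : ∀ x z, κ (x, z) = κ (z, x))
    (hη : ∀ y z, η (y, z) = η (z, y)) (h : sampleLaw μ κ = sampleLaw ν η) :
    (Measure.infinitePi fun _ : ℕ => μ).map (fun c => profile (pairLaw μ κ c)) =
      (Measure.infinitePi fun _ : ℕ => ν).map fun c => profile (pairLaw ν η c) := by
  rw [← map_empiricalProfile_comp_infinitePiKernel, ← map_empiricalProfile_comp_infinitePiKernel,
    ← map_blocks_sampleLaw μ κ hκ, ← map_blocks_sampleLaw ν η hη, h]

variable [StandardBorelSpace X] [StandardBorelSpace Y]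

theorem exists_coupling_of_pairLaw_eq [Nonempty E] {c : ℕ → X} {c' : ℕ → Y}
    (h : pairLaw μ κ c = pairLaw ν η c')
    (hc : ∀ᵐ p ∂((rowLaw μ κ c).prod (rowLaw μ κ c)),
      κ (p.1.1, p.2.1) = (pairLaw μ κ c).condKernel (p.1.2, p.2.2))
    (hc' : ∀ᵐ p ∂((rowLaw ν η c').prod (rowLaw ν η c')),
      η (p.1.1, p.2.1) = (pairLaw ν η c').condKernel (p.1.2, p.2.2)) :
    ∃ π : Measure (X × Y), IsProbabilityMeasure π ∧ π.map Prod.fst = μ ∧ π.map Prod.snd = ν ∧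
      ∀ᵐ q ∂(π.prod π), κ (q.1.1, q.2.1) = η (q.1.2, q.2.2) := by
  have hrows : (rowLaw μ κ c).snd = (rowLaw ν η c').snd := by
    rw [snd_rowLaw, snd_rowLaw, h]
  obtain ⟨ξ, _, hξ₁, hξ₂, hξ⟩ :=
    exists_coupling_of_map_eq _ _ measurable_snd measurable_snd hrows
  have hfst : MeasurePreserving Prod.fst ξ (rowLaw μ κ c) := ⟨measurable_fst, hξ₁⟩
  have hsnd : MeasurePreserving Prod.snd ξ (rowLaw ν η c') := ⟨measurable_snd, hξ₂⟩
  set θ : (X × (ℕ → E)) × (Y × (ℕ → E)) → X × Y := Prod.map Prod.fst Prod.fst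
  have hθ : Measurable θ := by fun_prop
  have hset : MeasurableSet {q : (X × Y) × (X × Y) | κ (q.1.1, q.2.1) = η (q.1.2, q.2.2)} :=
    measurableSet_setOf_kernel_eq
      (κ.comap (fun q : (X × Y) × (X × Y) => (q.1.1, q.2.1)) (by fun_prop))
      (η.comap (fun q : (X × Y) × (X × Y) => (q.1.2, q.2.2)) (by fun_prop))
  refine ⟨ξ.map θ, Measure.isProbabilityMeasure_map hθ.aemeasurable, ?_, ?_, ?_⟩
  · rw [Measure.map_map measurable_fst hθ]
    exact (⟨measurable_fst, fst_rowLaw μ κ c⟩ : MeasurePreserving Prod.fst _ μ).comp hfst |>.map_eq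
  · rw [Measure.map_map measurable_snd hθ]
    exact (⟨measurable_fst, fst_rowLaw ν η c'⟩ : MeasurePreserving Prod.fst _ ν).comp hsnd |>.map_eq
  · rw [Measure.map_prod_map _ _ hθ hθ, ae_map_iff (by fun_prop) hset]
    filter_upwards [(hfst.prod hfst).quasiMeasurePreserving.ae hc,
      (hsnd.prod hsnd).quasiMeasurePreserving.ae hc',
      Measure.quasiMeasurePreserving_fst.ae hξ, Measure.quasiMeasurePreserving_snd.ae hξ]
      with q hq hq' hrow₁ hrow₂
    simp only [Prod.map_fst, Prod.map_snd] at hq hq'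
    simp only [θ, Prod.map_fst, Prod.map_snd, hq, hq', hrow₁, hrow₂, h]

theorem exists_coupling_of_sampleLaw_eq (hκ : ∀ x z, κ (x, z) = κ (z, x))
    (hη : ∀ y z, η (y, z) = η (z, y)) (h : sampleLaw μ κ = sampleLaw ν η) :
    ∃ π : Measure (X × Y), IsProbabilityMeasure π ∧ π.map Prod.fst = μ ∧ π.map Prod.snd = ν ∧
      ∀ᵐ q ∂(π.prod π), κ (q.1.1, q.2.1) = η (q.1.2, q.2.2) := by
  have : Nonempty E := by
    obtain ⟨x⟩ := nonempty_of_isProbabilityMeasure μ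
    exact nonempty_of_isProbabilityMeasure (κ (x, x))
  obtain ⟨π, _, hπ₁, hπ₂, hπ⟩ := exists_coupling_of_map_eq _ _
    (measurable_profile.comp (pairLaw μ κ).measurable)
    (measurable_profile.comp (pairLaw ν η).measurable) (map_profile_pairLaw_eq μ κ ν η hκ hη h)
  have hanchors := ae_of_ae_map measurable_fst.aemeasurable
    (hπ₁ ▸ ae_ae_eq_condKernel_pairLaw μ κ hκ)
  have hanchors' := ae_of_ae_map measurable_snd.aemeasurable
    (hπ₂ ▸ ae_ae_eq_condKernel_pairLaw ν η hη)
  obtain ⟨q, hprofile, hq, hq'⟩ := (hπ.and (hanchors.and hanchors')).exists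
  exact exists_coupling_of_pairLaw_eq μ κ ν η (eq_of_profile_eq hprofile) hq hq'

end Reconstruction

section DeterminingClass

variable {ι E : Type*}

theorem isPiSystem_squareCylinders_isClosed [TopologicalSpace E] :
    IsPiSystem (squareCylinders fun _ : ι => {s : Set E | IsClosed s}) :=
  isPiSystem_squareCylinders (fun _ _ hs _ ht _ => hs.inter ht) fun _ => isClosed_univ

theorem generateFrom_squareCylinders_isClosed [TopologicalSpace E] [MeasurableSpace E]
    [BorelSpace E] :
    MeasurableSpace.generateFrom (squareCylinders fun _ : ι => {s : Set E | IsClosed s}) =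
      MeasurableSpace.pi := by
  classical
  refine le_antisymm (MeasurableSpace.generateFrom_le ?_) (iSup_le fun i => ?_)
  · rintro _ ⟨S, t, ht, rfl⟩
    exact .pi S.countable_toSet fun i _ => (ht i (Set.mem_univ i)).measurableSet
  · rw [BorelSpace.measurable_eq (α := E), borel_eq_generateFrom_isClosed,
      MeasurableSpace.comap_generateFrom]
    refine MeasurableSpace.generateFrom_mono ?_
    rintro _ ⟨s, hs, rfl⟩
    exact ⟨{i}, fun _ => s, fun _ _ => hs, by simp [Set.singleton_pi]⟩

variable [PseudoEMetricSpace E]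

theorem tendsto_prod_thickenedIndicator {δ : ℕ → ℝ} (hδ : ∀ n, 0 < δ n)
    (hlim : Tendsto δ atTop (𝓝 0)) (S : Finset ι) {t : ι → Set E} (ht : ∀ i, IsClosed (t i))
    (u : ι → E) :
    Tendsto (fun n => ∏ i ∈ S, (thickenedIndicator (hδ n) (t i) (u i) : ℝ)) atTop
      (𝓝 ((Set.pi S t).indicator 1 u)) := by
  classical
  rw [Set.indicator_pi_one_apply]
  refine tendsto_finsetProd S fun i _ => ?_
  have hi := tendsto_pi_nhds.1 (thickenedIndicator_tendsto_indicator_closure hδ hlim (t i)) (u i)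
  rw [(ht i).closure_eq, ← NNReal.tendsto_coe, NNReal.coe_indicator] at hi
  exact hi

variable [MeasurableSpace E] [BorelSpace E]

theorem tendsto_integral_prod_thickenedIndicator {δ : ℕ → ℝ} (hδ : ∀ n, 0 < δ n)
    (hlim : Tendsto δ atTop (𝓝 0)) (S : Finset ι) {t : ι → Set E} (ht : ∀ i, IsClosed (t i))
    (P : Measure (ι → E)) [IsFiniteMeasure P] :
    Tendsto (fun n => ∫ u, ∏ i ∈ S, (thickenedIndicator (hδ n) (t i) (u i) : ℝ) ∂P) atTop
      (𝓝 (P.real (Set.pi S t))) := by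
  rw [← integral_indicator_one (.pi S.countable_toSet fun i _ => (ht i).measurableSet)]
  refine tendsto_integral_of_dominated_convergence 1 (fun n => ?_) (integrable_const _)
    (fun n => ae_of_all _ fun u => ?_)
    (ae_of_all _ fun u => tendsto_prod_thickenedIndicator hδ hlim S ht u)
  · exact (Finset.measurable_prod S fun i _ => by fun_prop).aestronglyMeasurable
  · rw [Real.norm_of_nonneg (by positivity)]
    exact Finset.prod_le_one (fun _ _ => by positivity)
      fun i _ => NNReal.coe_le_one.2 (thickenedIndicator_le_one (hδ n) (t i) (u i))

theorem ext_of_integral_prod_lipschitz {P Q : Measure (ι → E)} [IsFiniteMeasure P]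
    [IsFiniteMeasure Q]
    (h : ∀ (S : Finset ι) (φ : ι → E → ℝ), (∀ i, ∃ K, LipschitzWith K (φ i)) →
      (∀ i t, φ i t ∈ Set.Icc 0 1) →
      ∫ u, ∏ i ∈ S, φ i (u i) ∂P = ∫ u, ∏ i ∈ S, φ i (u i) ∂Q) : P = Q := by
  have hδ : ∀ n : ℕ, (0 : ℝ) < 1 / (n + 1) := fun n => Nat.one_div_pos_of_nat
  have hpi : ∀ (S : Finset ι) (t : ι → Set E), (∀ i, IsClosed (t i)) →
      P (Set.pi S t) = Q (Set.pi S t) := by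
    intro S t ht
    rw [← measureReal_eq_measureReal_iff]
    have hlim := fun (R : Measure (ι → E)) [IsFiniteMeasure R] =>
      tendsto_integral_prod_thickenedIndicator hδ tendsto_one_div_add_atTop_nhds_zero_nat S ht R
    refine tendsto_nhds_unique ((hlim P).congr fun n => ?_) (hlim Q)
    exact h S _ (fun i => ⟨_, NNReal.isometry_coe.lipschitz.comp
      (lipschitzWith_thickenedIndicator (hδ n) (t i))⟩)
      fun i x => ⟨NNReal.coe_nonneg _,
        NNReal.coe_le_one.2 (thickenedIndicator_le_one (hδ n) (t i) x)⟩
  refine ext_of_generate_finite _ generateFrom_squareCylinders_isClosed.symm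
    isPiSystem_squareCylinders_isClosed ?_ ?_
  · rintro _ ⟨S, t, ht, rfl⟩
    exact hpi S t fun i => ht i (Set.mem_univ i)
  · simpa using hpi ∅ (fun _ => Set.univ) fun _ => isClosed_univ

end DeterminingClass

section Stability

open QMMSpace (Pairs dExt box)

theorem norm_prod_sub_prod_le_sum {ι R : Type*} [NormedCommRing R] [NormOneClass R]
    (S : Finset ι) {a b : ι → R} (ha : ∀ i ∈ S, ‖a i‖ ≤ 1) (hb : ∀ i ∈ S, ‖b i‖ ≤ 1) :
    ‖∏ i ∈ S, a i - ∏ i ∈ S, b i‖ ≤ ∑ i ∈ S, ‖a i - b i‖ := by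
  classical
  induction S using Finset.induction_on with
  | empty => simp
  | insert j S hj ih =>
    rw [Finset.forall_mem_insert] at ha hb
    rw [Finset.prod_insert hj, Finset.prod_insert hj, Finset.sum_insert hj]
    have hprod : ‖∏ i ∈ S, a i‖ ≤ 1 :=
      (S.norm_prod_le a).trans (Finset.prod_le_one (fun _ _ => norm_nonneg _) ha.2)
    calc ‖a j * ∏ i ∈ S, a i - b j * ∏ i ∈ S, b i‖
        = ‖(a j - b j) * ∏ i ∈ S, a i + b j * (∏ i ∈ S, a i - ∏ i ∈ S, b i)‖ := by ring_nf
      _ ≤ ‖a j - b j‖ * ‖∏ i ∈ S, a i‖ + ‖b j‖ * ‖∏ i ∈ S, a i - ∏ i ∈ S, b i‖ :=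
        (norm_add_le _ _).trans (add_le_add (norm_mul_le _ _) (norm_mul_le _ _))
      _ ≤ ‖a j - b j‖ * 1 + 1 * ∑ i ∈ S, ‖a i - b i‖ := by
        gcongr
        exacts [hb.1, ih ha.2 hb.2]
      _ = ‖a j - b j‖ + ∑ i ∈ S, ‖a i - b i‖ := by ring

theorem integral_prod_infinitePi {ι E 𝕜 : Type*} [RCLike 𝕜] [MeasurableSpace E] (P : ι → Measure E)
    [∀ i, IsProbabilityMeasure (P i)] (S : Finset ι) {φ : ι → E → 𝕜}
    (hφ : ∀ i, Measurable (φ i)) :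
    ∫ u, ∏ i ∈ S, φ i (u i) ∂(Measure.infinitePi P) = ∏ i ∈ S, ∫ t, φ i t ∂(P i) := by
  rw [← Finset.prod_coe_sort S fun i => ∫ t, φ i t ∂(P i),
    ← integral_fintype_prod_eq_prod fun i : S => φ i,
    ← integral_restrict_infinitePi (μ := P) (f := fun u : S → E => ∏ i : S, φ i (u i))
      (Finset.measurable_prod _ fun i _ => by fun_prop).aestronglyMeasurable]
  exact integral_congr_ae (ae_of_all _ fun u => (Finset.prod_coe_sort S fun i => φ i (u i)).symm)

theorem integral_mem_Icc_zero_one {A : Type*} [MeasurableSpace A] (ν : Measure A)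
    [IsProbabilityMeasure ν] {f : A → ℝ} (hf : ∀ t, f t ∈ Set.Icc 0 1) :
    ∫ t, f t ∂ν ∈ Set.Icc 0 1 := by
  refine ⟨integral_nonneg fun t => (hf t).1, ?_⟩
  simpa using integral_mono_of_nonneg (ae_of_all ν fun t => (hf t).1) (integrable_const (1 : ℝ))
    (ae_of_all ν fun t => (hf t).2)

theorem norm_prod_le_one_of_mem_Icc {ι : Type*} (S : Finset ι) {a : ι → ℝ}
    (ha : ∀ i, a i ∈ Set.Icc 0 1) : ‖∏ i ∈ S, a i‖ ≤ 1 := by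
  rw [Real.norm_of_nonneg (Finset.prod_nonneg fun i _ => (ha i).1)]
  exact Finset.prod_le_one (fun i _ => (ha i).1) fun i _ => (ha i).2

variable {X Y E : Type*} [MeasurableSpace X] [MeasurableSpace Y] [MeasurableSpace E]

theorem sampleLaw_comap (κ : Kernel (X × X) E) [IsMarkovKernel κ] {ρ : Measure Y}
    [IsProbabilityMeasure ρ] {μ : Measure X} [IsProbabilityMeasure μ] {Ψ : Y → X}
    (hΨ : MeasurePreserving Ψ ρ μ) :
    sampleLaw ρ (κ.comap (Prod.map Ψ Ψ) (hΨ.measurable.prodMap hΨ.measurable)) =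
      sampleLaw μ κ := by
  have hΨ' : Measurable fun (y : ℕ → Y) i => Ψ (y i) :=
    measurable_pi_iff.2 fun i => hΨ.measurable.comp (measurable_pi_apply i)
  have hmap : (Measure.infinitePi fun _ : ℕ => ρ).map (fun y i => Ψ (y i)) =
      Measure.infinitePi fun _ => μ := by
    rw [Measure.infinitePi_map_pi _ fun _ => hΨ.measurable]
    simp only [hΨ.map_eq]
  rw [sampleLaw, sampleLaw, ← hmap, ← Measure.deterministic_comp_eq_map hΨ', Measure.comp_assoc,
    Kernel.comp_deterministic_eq_comap]
  rfl

theorem integral_prod_sampleLaw (μ : Measure X) [IsProbabilityMeasure μ]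
    (κ : Kernel (X × X) E) [IsMarkovKernel κ] (S : Finset Pairs) {φ : Pairs → E → ℝ}
    (hφ : ∀ p, Measurable (φ p)) (hφ' : ∀ p t, φ p t ∈ Set.Icc 0 1) :
    ∫ u, ∏ p ∈ S, φ p (u p) ∂(sampleLaw μ κ) =
      ∫ x, ∏ p ∈ S, ∫ t, φ p t ∂(κ (x p.1.1, x p.1.2)) ∂(Measure.infinitePi fun _ : ℕ => μ) := by
  have hint : Integrable (fun u : Pairs → E => ∏ p ∈ S, φ p (u p)) (sampleLaw μ κ) :=
    .of_bound (Finset.measurable_prod S fun p _ => by fun_prop).aestronglyMeasurable 1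
      (ae_of_all _ fun u => norm_prod_le_one_of_mem_Icc S fun p => hφ' p (u p))
  rw [sampleLaw, Measure.comp_eq_comp_const_apply] at hint ⊢
  rw [Kernel.integral_comp hint, Kernel.const_apply]
  simp only [sampleKernel_apply, integral_prod_infinitePi _ S hφ]

theorem abs_integral_sub_integral_le_one (μ ν : Measure E) [IsProbabilityMeasure μ]
    [IsProbabilityMeasure ν] {φ : E → ℝ} (hφ : ∀ t, φ t ∈ Set.Icc 0 1) :
    |∫ t, φ t ∂μ - ∫ t, φ t ∂ν| ≤ 1 :=
  have hμ := integral_mem_Icc_zero_one μ hφ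
  have hν := integral_mem_Icc_zero_one ν hφ
  abs_sub_le_of_nonneg_of_le hμ.1 hμ.2 hν.1 hν.2

theorem measurePreserving_eval_pair {ι : Type*} (μ : Measure X) [IsProbabilityMeasure μ] {i j : ι}
    (hij : i ≠ j) : MeasurePreserving (fun x : ι → X => (x i, x j))
      (Measure.infinitePi fun _ => μ) (μ.prod μ) :=
  ⟨by fun_prop, Measure.infinitePi_map_eval_prod (P := fun _ : ι => μ) hij⟩

theorem abs_integral_prod_sampleLaw_sub_le (μ : Measure X) [IsProbabilityMeasure μ]
    (κ η : Kernel (X × X) E) [IsMarkovKernel κ] [IsMarkovKernel η] (S : Finset Pairs)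
    {φ : Pairs → E → ℝ} (hφ : ∀ p, Measurable (φ p)) (hφ' : ∀ p t, φ p t ∈ Set.Icc 0 1) :
    |∫ u, ∏ p ∈ S, φ p (u p) ∂(sampleLaw μ κ) - ∫ u, ∏ p ∈ S, φ p (u p) ∂(sampleLaw μ η)| ≤
      ∑ p ∈ S, ∫ q, |∫ t, φ p t ∂(κ q) - ∫ t, φ p t ∂(η q)| ∂(μ.prod μ) := by
  have hmeas (θ : Kernel (X × X) E) [IsMarkovKernel θ] (p : Pairs) :
      Measurable fun q => ∫ t, φ p t ∂(θ q) :=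
    (hφ p).stronglyMeasurable.integral_kernel.measurable
  have hmem (θ : Kernel (X × X) E) [IsMarkovKernel θ] (p : Pairs) (q : X × X) :
      ∫ t, φ p t ∂(θ q) ∈ Set.Icc 0 1 := integral_mem_Icc_zero_one (θ q) (hφ' p)
  have hnorm (θ : Kernel (X × X) E) [IsMarkovKernel θ] (p : Pairs) (q : X × X) :
      ‖∫ t, φ p t ∂(θ q)‖ ≤ 1 :=
    (Real.norm_of_nonneg (hmem θ p q).1).trans_le (hmem θ p q).2
  have hpoint (x : ℕ → X) :
      ‖∏ p ∈ S, ∫ t, φ p t ∂(κ (x p.1.1, x p.1.2)) - ∏ p ∈ S, ∫ t, φ p t ∂(η (x p.1.1, x p.1.2))‖ ≤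
        ∑ p ∈ S, |∫ t, φ p t ∂(κ (x p.1.1, x p.1.2)) - ∫ t, φ p t ∂(η (x p.1.1, x p.1.2))| :=
    norm_prod_sub_prod_le_sum S (fun p _ => hnorm κ p _) fun p _ => hnorm η p _
  have hint (θ : Kernel (X × X) E) [IsMarkovKernel θ] :
      Integrable (fun x : ℕ → X => ∏ p ∈ S, ∫ t, φ p t ∂(θ (x p.1.1, x p.1.2)))
        (Measure.infinitePi fun _ => μ) :=
    .of_bound (Finset.measurable_prod S fun p _ =>
      (hmeas θ p).comp (f := fun x : ℕ → X => (x p.1.1, x p.1.2))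
        (by fun_prop)).aestronglyMeasurable 1
      (ae_of_all _ fun x => norm_prod_le_one_of_mem_Icc S fun p => hmem θ p _)
  have hdiff (p : Pairs) : Integrable
      (fun q => |∫ t, φ p t ∂(κ q) - ∫ t, φ p t ∂(η q)|) (μ.prod μ) :=
    .of_bound ((hmeas κ p).sub (hmeas η p)).abs.aestronglyMeasurable 1
      (ae_of_all _ fun q => by
        rw [Real.norm_eq_abs, abs_abs]
        exact abs_integral_sub_integral_le_one (κ q) (η q) (hφ' p))
  have hpair (p : Pairs) := measurePreserving_eval_pair μ p.2.ne
  have hdiff' (p : Pairs) := (hpair p).integrable_comp_of_integrable (hdiff p)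
  rw [integral_prod_sampleLaw μ κ S hφ hφ', integral_prod_sampleLaw μ η S hφ hφ',
    ← integral_sub (hint κ) (hint η)]
  refine (norm_integral_le_of_norm_le (integrable_finsetSum S fun p _ => hdiff' p)
    (ae_of_all _ hpoint)).trans_eq ?_
  rw [integral_finsetSum S fun p _ => hdiff' p]
  refine Finset.sum_congr rfl fun p _ => ?_
  rw [← (hpair p).map_eq, integral_map (hpair p).measurable.aemeasurable
    ((hpair p).map_eq ▸ (hdiff p).aestronglyMeasurable)]
  rfl

theorem abs_integral_sub_le_of_dExt_le {ν ν' : ProbabilityMeasure I} {ε : ℝ} (hε : 0 ≤ ε)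
    (h : dExt ν ν' ≤ ENNReal.ofReal ε) {φ : I → ℝ} {K : ℝ≥0} (hφ : LipschitzWith K φ) :
    |∫ t, φ t ∂(ν : Measure I) - ∫ t, φ t ∂(ν' : Measure I)| ≤ K * ε := by
  rcases eq_or_ne K 0 with rfl | hK
  · have hconst : φ = fun _ => φ 0 := funext fun t => by simpa using hφ t 0
    rw [hconst]
    simp
  have hscaled : LipschitzWith 1 fun t => (K⁻¹ : ℝ) * φ t :=
    .of_dist_le_mul fun s t => by
      rw [Real.dist_eq, ← mul_sub, abs_mul, abs_of_nonneg (by positivity), NNReal.coe_one, one_mul,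
        inv_mul_le_iff₀ (by positivity)]
      exact hφ.dist_le_mul s t
  have hle := (le_iSup₂ (f := fun (f : I → ℝ) (_ : LipschitzWith 1 f) =>
    ENNReal.ofReal |∫ t, f t ∂(ν : Measure I) - ∫ t, f t ∂(ν' : Measure I)|) _ hscaled).trans h
  rwa [ENNReal.ofReal_le_ofReal_iff hε, integral_const_mul, integral_const_mul, ← mul_sub,
    abs_mul, abs_of_nonneg (by positivity), inv_mul_le_iff₀ (by positivity)] at hle

theorem integral_abs_sub_le_of_box_lt {f g : I → I → ProbabilityMeasure I} {ε : ℝ} (hε : 0 ≤ ε)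
    (h : box f g < ENNReal.ofReal ε) {φ : I → ℝ} {K : ℝ≥0} (hφ : LipschitzWith K φ)
    (hφ' : ∀ t, φ t ∈ Set.Icc 0 1) :
    ∫ p : I × I, |∫ t, φ t ∂(f p.1 p.2 : Measure I) - ∫ t, φ t ∂(g p.1 p.2 : Measure I)|
      ∂(volume.prod volume) ≤ (K + 2) * ε := by
  obtain ⟨ε', ⟨S, hS, hSε, hae⟩, hε'⟩ := sInf_lt_iff.1 h
  set a : I → ℝ := S.indicator 1
  have ha : Integrable a volume := (integrable_const _).indicator hS
  have ha_nonneg (s : I) : 0 ≤ a s := Set.indicator_nonneg (fun _ _ => zero_le_one) s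
  have ha_mem {s : I} (hs : s ∈ S) : a s = 1 := Set.indicator_of_mem hs _
  have hSε' : volume.real S ≤ ε := ENNReal.toReal_le_of_le_ofReal hε (hSε.trans hε'.le)
  have hbound : ∀ᵐ p : I × I ∂(volume.prod volume),
      |∫ t, φ t ∂(f p.1 p.2 : Measure I) - ∫ t, φ t ∂(g p.1 p.2 : Measure I)| ≤
        K * ε + (a p.1 + a p.2) := by
    filter_upwards [hae] with p hp
    have hKε : 0 ≤ K * ε := by positivity
    have hone : |∫ t, φ t ∂(f p.1 p.2 : Measure I) - ∫ t, φ t ∂(g p.1 p.2 : Measure I)| ≤ 1 :=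
      abs_integral_sub_integral_le_one _ _ hφ'
    by_cases h₁ : p.1 ∈ S
    · linarith [ha_mem h₁, ha_nonneg p.2]
    by_cases h₂ : p.2 ∈ S
    · linarith [ha_mem h₂, ha_nonneg p.1]
    · linarith [abs_integral_sub_le_of_dExt_le hε ((hp h₁ h₂).trans hε'.le) hφ, ha_nonneg p.1,
        ha_nonneg p.2]
  have hint : Integrable (fun p : I × I => a p.1 + a p.2) (volume.prod volume) :=
    (ha.comp_fst _).add (ha.comp_snd _)
  calc _ ≤ ∫ p : I × I, K * ε + (a p.1 + a p.2) ∂(volume.prod volume) :=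
        integral_mono_of_nonneg (ae_of_all _ fun _ => abs_nonneg _)
          ((integrable_const _).add hint) hbound
    _ = K * ε + (volume.real S + volume.real S) := by
        rw [integral_add (integrable_const _) hint,
          integral_add (ha.comp_fst _) (ha.comp_snd _), integral_fun_fst, integral_fun_snd]
        simp [a, integral_indicator_one hS]
    _ ≤ (K + 2) * ε := by linarith

end Stability

section MainTheorem

open QMMSpace (Pairs DistMatrix LawMatrix symmetrize measurable_symmetrize dExt box)

variable {X Y E : Type*} [MeasurableSpace X] [MeasurableSpace Y] [MeasurableSpace E]

theorem exists_measurePreserving_of_sampleLaw_eq [StandardBorelSpace X] [StandardBorelSpace Y]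
    [StandardBorelSpace E] (μ : Measure X) [IsProbabilityMeasure μ] (κ : Kernel (X × X) E)
    [IsMarkovKernel κ] (ν : Measure Y) [IsProbabilityMeasure ν] (η : Kernel (Y × Y) E)
    [IsMarkovKernel η] (hκ : ∀ x z, κ (x, z) = κ (z, x)) (hη : ∀ y z, η (y, z) = η (z, y))
    (h : sampleLaw μ κ = sampleLaw ν η) :
    ∃ (Ψ₁ : I → X) (Ψ₂ : I → Y), MeasurePreserving Ψ₁ volume μ ∧ MeasurePreserving Ψ₂ volume ν ∧
      ∀ᵐ p : I × I ∂(volume.prod volume), κ (Ψ₁ p.1, Ψ₁ p.2) = η (Ψ₂ p.1, Ψ₂ p.2) := by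
  obtain ⟨π, _, hfst, hsnd, hπ⟩ := exists_coupling_of_sampleLaw_eq μ κ ν η hκ hη h
  have : Nonempty (X × Y) := nonempty_of_isProbabilityMeasure π
  obtain ⟨Ψ, hΨ, hΨπ⟩ := Measure.exists_measurable_map_eq π
  have hΨ' : MeasurePreserving Ψ volume π := ⟨hΨ, hΨπ⟩
  exact ⟨Prod.fst ∘ Ψ, Prod.snd ∘ Ψ, .comp ⟨measurable_fst, hfst⟩ hΨ',
    .comp ⟨measurable_snd, hsnd⟩ hΨ', (hΨ'.prod hΨ').quasiMeasurePreserving.ae hπ⟩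

/-- A measurable map to the probability measures on `[0,1]`, seen as a Markov kernel. -/
noncomputable def lawKernel (d : X → X → ProbabilityMeasure I)
    (hd : Measurable fun p : X × X => d p.1 p.2) : Kernel (X × X) I :=
  ⟨fun p => d p.1 p.2, measurable_subtype_coe.comp hd⟩

instance (d : X → X → ProbabilityMeasure I) (hd : Measurable fun p : X × X => d p.1 p.2) :
    IsMarkovKernel (lawKernel d hd) :=
  ⟨fun p => inferInstanceAs (IsProbabilityMeasure (d p.1 p.2 : Measure I))⟩

theorem abs_integral_prod_sampleLaw_sub_le_of_box_lt {μ : Measure X} [IsProbabilityMeasure μ]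
    {ν : Measure Y} [IsProbabilityMeasure ν] {d : X → X → ProbabilityMeasure I}
    {d' : Y → Y → ProbabilityMeasure I} (hd : Measurable fun p : X × X => d p.1 p.2)
    (hd' : Measurable fun p : Y × Y => d' p.1 p.2) {Ψ₁ : I → X} {Ψ₂ : I → Y}
    (hΨ₁ : MeasurePreserving Ψ₁ volume μ) (hΨ₂ : MeasurePreserving Ψ₂ volume ν) {ε : ℝ}
    (hε : 0 ≤ ε) (h : box (fun s t => d (Ψ₁ s) (Ψ₁ t)) (fun s t => d' (Ψ₂ s) (Ψ₂ t)) <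
      ENNReal.ofReal ε) (S : Finset Pairs) {φ : Pairs → I → ℝ} {K : Pairs → ℝ≥0}
    (hφ : ∀ p, LipschitzWith (K p) (φ p)) (hφ' : ∀ p t, φ p t ∈ Set.Icc 0 1) :
    |∫ u, ∏ p ∈ S, φ p (u p) ∂(sampleLaw μ (lawKernel d hd)) -
      ∫ u, ∏ p ∈ S, φ p (u p) ∂(sampleLaw ν (lawKernel d' hd'))| ≤ (∑ p ∈ S, (K p + 2)) * ε := by
  rw [← sampleLaw_comap _ hΨ₁, ← sampleLaw_comap _ hΨ₂, NNReal.coe_sum, Finset.sum_mul]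
  exact (abs_integral_prod_sampleLaw_sub_le volume _ _ S
    (fun p => (hφ p).continuous.measurable) hφ').trans
    (Finset.sum_le_sum fun p _ => integral_abs_sub_le_of_box_lt hε h (hφ p) (hφ' p))

theorem sampleLaw_eq_of_iInf_box_eq_zero {μ : Measure X} [IsProbabilityMeasure μ]
    {ν : Measure Y} [IsProbabilityMeasure ν] {d : X → X → ProbabilityMeasure I}
    {d' : Y → Y → ProbabilityMeasure I} (hd : Measurable fun p : X × X => d p.1 p.2)
    (hd' : Measurable fun p : Y × Y => d' p.1 p.2)
    (h : ⨅ (Ψ₁ : {Ψ : I → X // MeasurePreserving Ψ volume μ})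
      (Ψ₂ : {Ψ : I → Y // MeasurePreserving Ψ volume ν}),
      box (fun s t => d (Ψ₁.1 s) (Ψ₁.1 t)) (fun s t => d' (Ψ₂.1 s) (Ψ₂.1 t)) = 0) :
    sampleLaw μ (lawKernel d hd) = sampleLaw ν (lawKernel d' hd') := by
  refine ext_of_integral_prod_lipschitz fun S φ hφ hφ' => eq_of_forall_dist_le fun δ hδ => ?_
  choose K hK using hφ
  have hε : 0 < δ / (∑ p ∈ S, (K p + 2) + 1 : ℝ≥0) := by positivity
  have hlt := h.trans_lt (ENNReal.ofReal_pos.2 hε)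
  simp only [iInf_lt_iff] at hlt
  obtain ⟨Ψ₁, Ψ₂, hbox⟩ := hlt
  refine (abs_integral_prod_sampleLaw_sub_le_of_box_lt hd hd' Ψ₁.2 Ψ₂.2 hε.le hbox S hK
    hφ').trans ?_
  rw [mul_div_assoc', div_le_iff₀ (by positivity), mul_comm]
  gcongr
  simp

theorem box_eq_zero_of_ae_eq {f g : I → I → ProbabilityMeasure I}
    (h : ∀ᵐ p : I × I ∂(volume.prod volume), f p.1 p.2 = g p.1 p.2) : box f g = 0 := by
  refine le_antisymm (sInf_le ⟨∅, .empty, by simp, ?_⟩) bot_le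
  filter_upwards [h] with p hp _ _
  simp [hp, dExt]

theorem mainTheorem2_general [StandardBorelSpace X] [StandardBorelSpace Y] (μ : Measure X)
    [IsProbabilityMeasure μ] (ν : Measure Y) [IsProbabilityMeasure ν]
    {d : X → X → ProbabilityMeasure I} {d' : Y → Y → ProbabilityMeasure I}
    (hd : Measurable fun p : X × X => d p.1 p.2) (hd' : Measurable fun p : Y × Y => d' p.1 p.2)
    (hsymm : ∀ x z, d x z = d z x) (hsymm' : ∀ y z, d' y z = d' z y) :
    (sampleLaw μ (lawKernel d hd) = sampleLaw ν (lawKernel d' hd') ↔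
      ⨅ (Ψ₁ : {Ψ : I → X // MeasurePreserving Ψ volume μ})
        (Ψ₂ : {Ψ : I → Y // MeasurePreserving Ψ volume ν}),
        box (fun s t => d (Ψ₁.1 s) (Ψ₁.1 t)) (fun s t => d' (Ψ₂.1 s) (Ψ₂.1 t)) = 0) ∧
      (sampleLaw μ (lawKernel d hd) = sampleLaw ν (lawKernel d' hd') →
        ∃ (Ψ₁ : {Ψ : I → X // MeasurePreserving Ψ volume μ})
          (Ψ₂ : {Ψ : I → Y // MeasurePreserving Ψ volume ν}),
          ∀ᵐ p : I × I ∂(volume.prod volume),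
            d (Ψ₁.1 p.1) (Ψ₁.1 p.2) = d' (Ψ₂.1 p.1) (Ψ₂.1 p.2)) := by
  have hexists (h : sampleLaw μ (lawKernel d hd) = sampleLaw ν (lawKernel d' hd')) :
      ∃ (Ψ₁ : {Ψ : I → X // MeasurePreserving Ψ volume μ})
        (Ψ₂ : {Ψ : I → Y // MeasurePreserving Ψ volume ν}),
        ∀ᵐ p : I × I ∂(volume.prod volume),
          d (Ψ₁.1 p.1) (Ψ₁.1 p.2) = d' (Ψ₂.1 p.1) (Ψ₂.1 p.2) := by
    obtain ⟨Ψ₁, Ψ₂, hΨ₁, hΨ₂, hae⟩ := exists_measurePreserving_of_sampleLaw_eq μ _ ν _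
      (fun x z => congrArg ProbabilityMeasure.toMeasure (hsymm x z))
      (fun y z => congrArg ProbabilityMeasure.toMeasure (hsymm' y z)) h
    exact ⟨⟨Ψ₁, hΨ₁⟩, ⟨Ψ₂, hΨ₂⟩, hae.mono fun _ hp => Subtype.ext hp⟩
  refine ⟨⟨fun h => ?_, sampleLaw_eq_of_iInf_box_eq_zero hd hd'⟩, hexists⟩
  obtain ⟨Ψ₁, Ψ₂, hae⟩ := hexists h
  exact le_antisymm ((iInf₂_le Ψ₁ Ψ₂).trans_eq (box_eq_zero_of_ae_eq hae)) bot_le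

theorem coe_τ_eq_map_sampleLaw [StandardBorelSpace X] (Q : QMMSpace X) :
    (Q.τ : Measure DistMatrix) =
      (sampleLaw Q.μ (lawKernel Q.d Q.measurable_d)).map symmetrize := by
  ext A hA
  change Q.lawMatrixMeasure.bind LawMatrix.toMeasure A = _
  rw [Measure.bind_apply hA LawMatrix.measurable_toMeasure.aemeasurable, QMMSpace.lawMatrixMeasure,
    lintegral_map (f := fun s : LawMatrix => s.toMeasure A)
      ((Measure.measurable_coe hA).comp LawMatrix.measurable_toMeasure) Q.measurable_lawMatrix,
    Measure.map_apply measurable_symmetrize hA, sampleLaw,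
    Measure.bind_apply (measurable_symmetrize hA) (Kernel.aemeasurable _)]
  refine lintegral_congr fun x => ?_
  rw [LawMatrix.toMeasure, Measure.map_apply measurable_symmetrize hA]
  rfl

theorem map_entries_map_symmetrize (ρ : Measure (Pairs → I)) :
    (ρ.map symmetrize).map (fun D p => D.1 p.1.1 p.1.2) = ρ := by
  have hmeas : Measurable fun (D : DistMatrix) (p : Pairs) => D.1 p.1.1 p.1.2 :=
    measurable_pi_iff.2 fun p => (measurable_pi_apply _).comp
      ((measurable_pi_apply _).comp measurable_subtype_coe)
  have hinv : (fun (D : DistMatrix) (p : Pairs) => D.1 p.1.1 p.1.2) ∘ symmetrize = id := by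
    funext u p
    simp [symmetrize, p.2]
  rw [Measure.map_map hmeas measurable_symmetrize, hinv, Measure.map_id]

theorem τ_eq_iff_sampleLaw_eq [StandardBorelSpace X] [StandardBorelSpace Y] (P : QMMSpace X)
    (Q : QMMSpace Y) :
    P.τ = Q.τ ↔ sampleLaw (P.μ : Measure X) (lawKernel P.d P.measurable_d) =
      sampleLaw (Q.μ : Measure Y) (lawKernel Q.d Q.measurable_d) := by
  rw [← (Function.LeftInverse.injective map_entries_map_symmetrize).eq_iff,
    ← coe_τ_eq_map_sampleLaw, ← coe_τ_eq_map_sampleLaw]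
  exact Subtype.ext_iff

end MainTheorem

theorem mainTheorem2 {X Y : Type*} [MeasurableSpace X] [StandardBorelSpace X]
    [MeasurableSpace Y] [StandardBorelSpace Y] (P : QMMSpace X) (Q : QMMSpace Y) :
    (P.τ = Q.τ ↔ P.boxDist Q = 0) ∧
      (P.τ = Q.τ → ∃ (Ψ₁ : P.MPM) (Ψ₂ : Q.MPM),
        ∀ᵐ p : I × I ∂(volume.prod volume),
          P.pullback Ψ₁ p.1 p.2 = Q.pullback Ψ₂ p.1 p.2) := by
  rw [τ_eq_iff_sampleLaw_eq]
  exact mainTheorem2_general _ _ P.measurable_d Q.measurable_d P.d_symm Q.d_symm
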